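/- Let $G$ be a finite group of squarefree order. Write $\mathrm{Perm}(G)$ for the group of permutations of the set $G$, let $\mathrm{Hol}(G)=\rho(G)\rtimes\mathrm{Aut}(G)\le\mathrm{Perm}(G)$ be the holomorph of $G$, where $\rho(\sigma)(x)=x\sigma^{-1}$, let $\mathrm{NHol}(G)$ be the normalizer of $\mathrm{Hol}(G)$ in $\mathrm{Perm}(G)$, and put $T(G)=\mathrm{NHol}(G)/\mathrm{Hol}(G)$. There are positive integers $d,e,k$, with $k$ coprime to $e$ and of multiplicative order $d$ modulo $e$, such that $$G\simeq G(d,e,k)=\langle\sigma,\tau : \sigma^e=1,\ \tau^d=1,\ \tau\sigma\tau^{-1}=\sigma^k\rangle .$$ The group $T(G)$ is elementary $2$-abelian, that is, it is abelian and $x^2=1$ for all $x\in T(G)$ (the trivial group is allowed). Moreover, for all positive integers $d,e,k$ as above with $G\simeq G(d,e,k)$, put $z=\gcd(e,k-1)$ and $g=e/z$, and for each divisor $f$ of $g$ let $d_f$ be the multiplicative order of $k$ modulo $f$. Then $$|T(G)|=\#\mathfrak{o}(G),\qquad \mathfrak{o}(G)=\{(f_1,f_2)\in\mathbb{N}^2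 : g=f_1f_2\ \text{and}\ \gcd(d_{f_1},d_{f_2})\le 2\},$$ where $\mathbb{N}$ is the set of positive integers. Further, $\#\mathfrak{o}(G)=2^{c}$, where $c$ is the number of connected components of the graph whose vertices are the prime divisors of $g$ and in which two distinct primes $q,q'$ are joined by an edge if and only if $\gcd(d_q,d_{q'})\ge 3$. -/

import Mathlib

namespace MultipleHolomorph

section Holomorph

/-- The right regular representation `ρ : G → Perm G`, `ρ σ = (x ↦ x σ⁻¹)`. -/
def rho (G : Type*) [Group G] : G →* Equiv.Perm G where
  toFun σ := Equiv.mulRight σ⁻¹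
  map_one' := by ext x; simp
  map_mul' a b := by ext x; simp [mul_assoc]

/-- The holomorph of `G` as a subgroup of `Perm G`: the internal (semidirect) product of `ρ(G)`
and `Aut G`, i.e. the subgroup generated by these two. -/
def Hol (G : Type*) [Group G] : Subgroup (Equiv.Perm G) :=
  (rho G).range ⊔ (MulAut.toPerm G).range

/-- The multiple holomorph of `G`: the normalizer of the holomorph in `Perm G`. -/
def NHol (G : Type*) [Group G] : Subgroup (Equiv.Perm G) :=
  Subgroup.normalizer (Hol G : Set (Equiv.Perm G))

instance (G : Type*) [Group G] : ((Hol G).subgroupOf (NHol G)).Normal :=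
  Subgroup.normal_in_normalizer

/-- The quotient group `T(G) = NHol(G) / Hol(G)`. -/
abbrev T (G : Type*) [Group G] : Type _ :=
  NHol G ⧸ (Hol G).subgroupOf (NHol G)

/-- A group is elementary `2`-abelian if it is abelian and every element squares to the identity
(the trivial group is included). -/
def IsElementaryTwoAbelian (A : Type*) [Group A] : Prop :=
  (∀ x y : A, x * y = y * x) ∧ ∀ x : A, x ^ 2 = 1

end Holomorph

section Presentation

/-- The relators of `⟨σ, τ : σ ^ e = 1, τ ^ d = 1, τ σ τ⁻¹ = σ ^ k⟩`, with `σ` the generator `0`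
and `τ` the generator `1`. -/
def relators (d e k : ℕ) : Set (FreeGroup (Fin 2)) :=
  {FreeGroup.of 0 ^ e,
   FreeGroup.of 1 ^ d,
   FreeGroup.of 1 * FreeGroup.of 0 * (FreeGroup.of 1)⁻¹ * (FreeGroup.of 0 ^ k)⁻¹}

/-- The group `G(d, e, k) = ⟨σ, τ : σ ^ e = 1, τ ^ d = 1, τ σ τ⁻¹ = σ ^ k⟩`. -/
abbrev GroupOf (d e k : ℕ) : Type := PresentedGroup (relators d e k)

/-- The multiplicative order of `k` modulo `f`. -/
noncomputable def ordMod (k f : ℕ) : ℕ := orderOf (k : ZMod f)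

/-- Conditions on the parameters of a presentation: `d`, `e`, `k` are positive, `k` is coprime to
`e`, and the multiplicative order of `k` modulo `e` is `d`. -/
structure IsParams (d e k : ℕ) : Prop where
  d_pos : 0 < d
  e_pos : 0 < e
  k_pos : 0 < k
  coprime : Nat.Coprime k e
  ord_eq : ordMod k e = d

/-- `z = gcd(e, k - 1)`. -/
def zOf (e k : ℕ) : ℕ := Nat.gcd e (k - 1)

/-- `g = e / z` (an exact division). -/
def gOf (e k : ℕ) : ℕ := e / zOf e k

/-- The set `𝔬` of pairs `(f₁, f₂)` of positive integers with `g = f₁ f₂` and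
`gcd(d_{f₁}, d_{f₂}) ≤ 2`, where `d_f` is the multiplicative order of `k` modulo `f`. -/
def oSet (g k : ℕ) : Set (ℕ × ℕ) :=
  {p | 0 < p.1 ∧ 0 < p.2 ∧ g = p.1 * p.2 ∧ Nat.gcd (ordMod k p.1) (ordMod k p.2) ≤ 2}

/-- The graph on the prime factors of `g`, in which distinct `q`, `q'` are joined if and only if
`gcd(d_q, d_{q'}) ≥ 3`. -/
def primeGraph (g k : ℕ) : SimpleGraph {q : ℕ // q ∈ g.primeFactors} where
  Adj q q' := q ≠ q' ∧ 3 ≤ Nat.gcd (ordMod k q) (ordMod k q')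
  symm := ⟨fun _ _ h => ⟨h.1.symm, by rw [Nat.gcd_comm]; exact h.2⟩⟩
  loopless := ⟨fun _ h => h.1 rfl⟩

end Presentation

end MultipleHolomorph

/-! Identify `G` with `ZMod e × ZMod d` under `(x, t)(y, s) = (x + χ(t) y, t + s)`, where `χ` is an
injective character and `d`, `e` are coprime and squarefree. The holomorph becomes the group of maps
`(x, t) ↦ (u x + b + a χ(t), t + c)` (`IsCoords.map_hol`), so everything reduces to the normalizer
of `affGroup χ`.

A normalizing permutation has the form `(x, t) ↦ (β(t) + u ψ(t) x, v t + c)` with `ψ` a character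
(`exists_form_of_mem_normalizer`). Both `ψ` and `ψ χ` are affine in `χ(v t)`. Modulo a prime, a
character affine in another one is trivial or equal to it, so at each prime of `e` either `ψ` is
trivial and `v` fixes `χ`, or `ψ = χ⁻¹` and `v` inverts `χ` (`isTwist_of_affine`). Averaging over
`ZMod d` shows that `β` contributes only an affine factor (`exists_affine_of_shift`). The
involutions `(x, t) ↦ (ψ(t) x, v t)` are therefore coset representatives, which gives exponent 2 and
`|T(G)|` = number of twists.

A twist amounts to a set of primes of `g` at which `k` is inverted. A suitable `v` must be `1`
modulo `d_{f₁}` and `-1` modulo `d_{f₂}`, which is solvable exactly when `gcd(d_{f₁}, d_{f₂})`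
divides 2 (`gcd_ordMod_le_two_iff_exists`). This condition can be tested on pairs of primes
(`gcd_ordMod_le_two_iff`), so the admissible sets are the unions of connected components. -/

namespace MultipleHolomorph

open Equiv

/-! ### Semidirect product coordinates for the presented group -/

section Coordinates

variable {d e : ℕ}

/-- `E` identifies `G` with the semidirect product of `ZMod e` and `ZMod d` with action `χ`. -/
def IsCoords {G : Type*} [Group G] (χ : AddChar (ZMod d) (ZMod e))
    (E : G ≃ ZMod e × ZMod d) : Prop :=
  ∀ g h, E (g * h) = ((E g).1 + χ (E g).2 * (E h).1, (E g).2 + (E h).2)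

theorem addChar_mul_neg {A R : Type*} [AddGroup A] [CommMonoid R] (χ : AddChar A R) (t : A) :
    χ t * χ (-t) = 1 := by
  rw [← AddChar.map_add_eq_mul, add_neg_cancel, AddChar.map_zero_eq_one]

theorem addChar_neg_mul {A R : Type*} [AddGroup A] [CommMonoid R] (χ : AddChar A R) (t : A) :
    χ (-t) * χ t = 1 := by
  rw [← AddChar.map_add_eq_mul, neg_add_cancel, AddChar.map_zero_eq_one]

/-- The semidirect product of `ZMod e` and `ZMod d` with action `χ`. -/
@[ext] structure Metacyclic (χ : AddChar (ZMod d) (ZMod e)) where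
  /-- The coordinate in the normal factor. -/
  fst : ZMod e
  /-- The coordinate in the acting factor. -/
  snd : ZMod d

namespace Metacyclic

variable {χ : AddChar (ZMod d) (ZMod e)}

instance : Mul (Metacyclic χ) := ⟨fun p q => ⟨p.fst + χ p.snd * q.fst, p.snd + q.snd⟩⟩
instance : One (Metacyclic χ) := ⟨⟨0, 0⟩⟩
instance : Inv (Metacyclic χ) := ⟨fun p => ⟨-(χ (-p.snd) * p.fst), -p.snd⟩⟩

@[simp] theorem mul_fst (p q : Metacyclic χ) : (p * q).fst = p.fst + χ p.snd * q.fst := rfl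
@[simp] theorem mul_snd (p q : Metacyclic χ) : (p * q).snd = p.snd + q.snd := rfl
@[simp] theorem one_fst : (1 : Metacyclic χ).fst = 0 := rfl
@[simp] theorem one_snd : (1 : Metacyclic χ).snd = 0 := rfl
@[simp] theorem inv_fst (p : Metacyclic χ) : p⁻¹.fst = -(χ (-p.snd) * p.fst) := rfl
@[simp] theorem inv_snd (p : Metacyclic χ) : p⁻¹.snd = -p.snd := rfl

instance : Group (Metacyclic χ) :=
  Group.ofLeftAxioms
    (fun p q r => by
      ext
      · simp only [mul_fst, mul_snd, AddChar.map_add_eq_mul]; ring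
      · simp [add_assoc])
    (fun p => by ext <;> simp)
    (fun p => by ext <;> simp)

/-- The coordinates as an equivalence. -/
def equivProd (χ : AddChar (ZMod d) (ZMod e)) : Metacyclic χ ≃ ZMod e × ZMod d where
  toFun p := (p.fst, p.snd)
  invFun p := ⟨p.1, p.2⟩

end Metacyclic

/-- The action of the second generator of `GroupOf d e k` on the first one. -/
theorem pow_mul_pow_of_conj {G : Type*} [Group G] {σ τ : G} {k : ℕ}
    (h : τ * σ * τ⁻¹ = σ ^ k) (n m : ℕ) : τ ^ n * σ ^ m = σ ^ (k ^ n * m) * τ ^ n := by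
  have h1 : ∀ m : ℕ, τ * σ ^ m = σ ^ (k * m) * τ := by
    intro m
    rw [pow_mul, ← h, conj_pow]; group
  induction n generalizing m with
  | zero => simp
  | succ n ih =>
    rw [pow_succ', mul_assoc, ih, ← mul_assoc, h1, mul_assoc, pow_succ', mul_assoc]

/-- The relations hold in the semidirect product, which gives a map out of the presented group; the
normal form `σ ^ x * τ ^ t` gives its inverse. That `k` has order exactly `d` makes `χ` both well
defined and injective. -/
theorem exists_coords {k : ℕ} (h : IsParams d e k) :
    ∃ χ : AddChar (ZMod d) (ZMod e), χ 1 = k ∧ Function.Injective χ ∧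
      ∃ E : GroupOf d e k ≃ ZMod e × ZMod d, IsCoords χ E := by
  have : NeZero d := ⟨h.d_pos.ne'⟩
  have : NeZero e := ⟨h.e_pos.ne'⟩
  have hord : orderOf (k : ZMod e) = d := h.ord_eq
  have hk : (k : ZMod e) ^ d = 1 := by rw [← hord, pow_orderOf_eq_one]
  let χ := AddChar.zmodChar d hk
  have hχ : ∀ n : ℕ, χ n = (k : ZMod e) ^ n := AddChar.zmodChar_apply' hk
  refine ⟨χ, by simpa using hχ 1, ?_, ?_⟩
  · intro a b hab
    rw [← ZMod.natCast_zmod_val a, ← ZMod.natCast_zmod_val b, hχ,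
      hχ] at hab
    exact ZMod.val_injective _ (pow_injOn_Iio_orderOf (by simpa [hord] using ZMod.val_lt a)
      (by simpa [hord] using ZMod.val_lt b) hab)
  let s : Metacyclic χ := ⟨1, 0⟩
  let t : Metacyclic χ := ⟨0, 1⟩
  have hs : ∀ n : ℕ, s ^ n = ⟨(n : ZMod e), 0⟩ := by
    intro n
    induction n with
    | zero => ext <;> simp
    | succ n ih => rw [pow_succ, ih]; ext <;> simp [s]
  have ht : ∀ n : ℕ, t ^ n = ⟨0, (n : ZMod d)⟩ := by
    intro n
    induction n with
    | zero => ext <;> simp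
    | succ n ih => rw [pow_succ, ih]; ext <;> simp [t]
  have hts : t * s = s ^ k * t := by
    have := hχ 1
    simp only [Nat.cast_one, pow_one] at this
    rw [hs]
    ext <;> simp [s, t, this]
  let f : Fin 2 → Metacyclic χ := ![s, t]
  have hf : ∀ r ∈ relators d e k, FreeGroup.lift f r = 1 := by
    intro r hr
    rcases hr with rfl | rfl | rfl
    · simp [f, hs]; rfl
    · simp [f, ht]; rfl
    · simp [f, hts]
  let F : GroupOf d e k →* Metacyclic χ := PresentedGroup.toGroup hf
  let σ : GroupOf d e k := PresentedGroup.of 0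
  let τ : GroupOf d e k := PresentedGroup.of 1
  have hFσ : F σ = s := PresentedGroup.toGroup.of hf
  have hFτ : F τ = t := PresentedGroup.toGroup.of hf
  have hσ : σ ^ e = 1 := PresentedGroup.one_of_mem (rels := relators d e k)
    (x := FreeGroup.of 0 ^ e) (by simp [relators])
  have hτ : τ ^ d = 1 := PresentedGroup.one_of_mem (rels := relators d e k)
    (x := FreeGroup.of 1 ^ d) (by simp [relators])
  have hrel : τ * σ * τ⁻¹ = σ ^ k := mul_inv_eq_one.mp <|
    PresentedGroup.one_of_mem (rels := relators d e k)
    (x := FreeGroup.of 1 * FreeGroup.of 0 * (FreeGroup.of 1)⁻¹ * (FreeGroup.of 0 ^ k)⁻¹)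
    (by simp [relators])
  -- The inverse uses representatives of residues; the relations `σ ^ e = 1` and `τ ^ d = 1` make it
  -- insensitive to that choice.
  let I : Metacyclic χ → GroupOf d e k := fun p => σ ^ p.fst.val * τ ^ p.snd.val
  have hσmod : ∀ {a b : ℕ}, (a : ZMod e) = b → σ ^ a = σ ^ b := by
    intro a b hab
    rw [ZMod.natCast_eq_natCast_iff'] at hab
    rw [pow_eq_pow_mod a hσ, hab, ← pow_eq_pow_mod b hσ]
  have hτmod : ∀ {a b : ℕ}, (a : ZMod d) = b → τ ^ a = τ ^ b := by
    intro a b hab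
    rw [ZMod.natCast_eq_natCast_iff'] at hab
    rw [pow_eq_pow_mod a hτ, hab, ← pow_eq_pow_mod b hτ]
  have hI : ∀ p q, I (p * q) = I p * I q := by
    intro p q
    have h1 : σ ^ (p * q).fst.val = σ ^ p.fst.val * σ ^ (k ^ p.snd.val * q.fst.val) := by
      rw [← pow_add]
      apply hσmod
      rw [ZMod.natCast_zmod_val]
      simp only [Metacyclic.mul_fst]
      push_cast
      rw [ZMod.natCast_zmod_val, ZMod.natCast_zmod_val, ← hχ, ZMod.natCast_zmod_val]
    have h2 : τ ^ (p * q).snd.val = τ ^ p.snd.val * τ ^ q.snd.val := by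
      rw [← pow_add]
      apply hτmod
      rw [ZMod.natCast_zmod_val]
      simp only [Metacyclic.mul_snd]
      push_cast
      rw [ZMod.natCast_zmod_val, ZMod.natCast_zmod_val]
    change σ ^ (p * q).fst.val * τ ^ (p * q).snd.val =
      (σ ^ p.fst.val * τ ^ p.snd.val) * (σ ^ q.fst.val * τ ^ q.snd.val)
    have h3 := pow_mul_pow_of_conj hrel p.snd.val q.fst.val
    rw [h1, h2, mul_assoc, mul_assoc, ← mul_assoc (τ ^ _) (σ ^ _), h3]
    simp only [mul_assoc]
  let I' : Metacyclic χ →* GroupOf d e k := MonoidHom.mk' I hI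
  have hI's : I' s = σ := by
    change σ ^ (1 : ZMod e).val * τ ^ (0 : ZMod d).val = σ
    rw [ZMod.val_zero, pow_zero, mul_one,
      hσmod (b := 1) (by rw [ZMod.natCast_zmod_val, Nat.cast_one]), pow_one]
  have hI't : I' t = τ := by
    change σ ^ (0 : ZMod e).val * τ ^ (1 : ZMod d).val = τ
    rw [ZMod.val_zero, pow_zero, one_mul,
      hτmod (b := 1) (by rw [ZMod.natCast_zmod_val, Nat.cast_one]), pow_one]
  have hIF : I'.comp F = MonoidHom.id _ := by
    apply PresentedGroup.ext
    intro x
    fin_cases x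
    · change I' (F σ) = σ
      rw [hFσ, hI's]
    · change I' (F τ) = τ
      rw [hFτ, hI't]
  have hFI : ∀ p, F (I' p) = p := by
    intro p
    change F (σ ^ p.fst.val * τ ^ p.snd.val) = p
    rw [map_mul, map_pow, map_pow, hFσ, hFτ, hs, ht]
    ext <;> simp
  refine ⟨(Equiv.mk F I' (fun x => DFunLike.congr_fun hIF x) hFI).trans (Metacyclic.equivProd χ),
    fun g h => ?_⟩
  simp [Metacyclic.equivProd]

end Coordinates

/-! ### The holomorph as a group of affine permutations -/

section Affine

variable {d e : ℕ}

/-- A function on a finite cyclic group satisfying an affine recurrence is affine in a character,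
by averaging. -/
theorem exists_affine_of_shift {R : Type*} [CommRing R] [NeZero d] (hd : IsUnit (d : R))
    (ψ κ : AddChar (ZMod d) R) (A B : R) (hψ : ∀ t, ψ t = B + A * κ t) (β : ZMod d → R)
    (hβ : ∀ c, ∃ a b, ∀ t, β (t + c) = ψ c * β t + b + a * κ t) :
    ∃ a b, ∀ t, β t = b + a * κ t := by
  choose a b hab using hβ
  obtain ⟨w, hw⟩ := hd
  set C := ∑ s, ψ (-s) * β s with hC
  -- Evaluate the sum of `ψ(-c) β(t + c)` over `c` twice: reindexing by `s = t + c` gives `ψ(t) C`,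
  -- while the recurrence gives `d β(t)` plus an affine expression in `κ(t)`.
  have key : ∀ t, (d : R) * β t =
      ψ t * C - ∑ c, ψ (-c) * b c - (∑ c, ψ (-c) * a c) * κ t := by
    intro t
    have h1 : ∑ c, ψ (-c) * β (t + c) = ψ t * C := by
      rw [hC, Finset.mul_sum, ← Equiv.sum_comp (Equiv.addLeft t) fun s => ψ t * (ψ (-s) * β s)]
      refine Finset.sum_congr rfl fun c _ => ?_
      rw [Equiv.coe_addLeft, neg_add, AddChar.map_add_eq_mul]
      linear_combination (-ψ (-c) * β (t + c)) * addChar_mul_neg ψ t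
    have h2 : ∀ c, ψ (-c) * β (t + c) = β t + ψ (-c) * b c + ψ (-c) * a c * κ t := by
      intro c
      rw [hab]
      linear_combination β t * addChar_neg_mul ψ c
    rw [← h1, Finset.sum_congr rfl fun c _ => h2 c, Finset.sum_add_distrib,
      Finset.sum_add_distrib, Finset.sum_const, Finset.card_univ, ZMod.card, nsmul_eq_mul,
      Finset.sum_mul]
    ring
  refine ⟨↑w⁻¹ * (A * C - ∑ c, ψ (-c) * a c), ↑w⁻¹ * (B * C - ∑ c, ψ (-c) * b c), fun t => ?_⟩
  have h3 := key t
  rw [← hw, hψ t] at h3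
  have h4 : (↑w⁻¹ : R) * w = 1 := w.inv_mul
  linear_combination (↑w⁻¹ : R) * h3 - β t * h4

/-- The permutation `(x, t) ↦ (u x + b + a χ(t), t + c)`. -/
def affPerm (χ : AddChar (ZMod d) (ZMod e)) (u : (ZMod e)ˣ) (a b : ZMod e) (c : ZMod d) :
    Perm (ZMod e × ZMod d) where
  toFun p := (u * p.1 + b + a * χ p.2, p.2 + c)
  invFun p := (↑u⁻¹ * (p.1 - b - a * χ (p.2 - c)), p.2 - c)
  left_inv p := by
    ext
    · simp only [add_sub_cancel_right]
      linear_combination p.1 * u.inv_mul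
    · simp
  right_inv p := by
    ext
    · linear_combination (p.1 - b - a * χ (p.2 - c)) * u.mul_inv
    · simp

variable (χ : AddChar (ZMod d) (ZMod e))

@[simp] theorem affPerm_apply (u : (ZMod e)ˣ) (a b : ZMod e) (c : ZMod d) (x : ZMod e)
    (t : ZMod d) : affPerm χ u a b c (x, t) = (u * x + b + a * χ t, t + c) := rfl

theorem affPerm_mul (u u' : (ZMod e)ˣ) (a a' b b' : ZMod e) (c c' : ZMod d) :
    affPerm χ u' a' b' c' * affPerm χ u a b c =
      affPerm χ (u' * u) (u' * a + a' * χ c) (u' * b + b') (c + c') := by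
  ext ⟨x, t⟩
  · simp only [Perm.mul_apply, affPerm_apply, AddChar.map_add_eq_mul, Units.val_mul]; ring
  · simp [add_assoc]

theorem affPerm_one : affPerm χ 1 0 0 0 = 1 := by
  ext ⟨x, t⟩ <;> simp

theorem affPerm_inv (u : (ZMod e)ˣ) (a b : ZMod e) (c : ZMod d) :
    (affPerm χ u a b c)⁻¹ = affPerm χ u⁻¹ (-(↑u⁻¹ * a * χ (-c))) (-(↑u⁻¹ * b)) (-c) := by
  rw [inv_eq_iff_mul_eq_one, affPerm_mul, ← affPerm_one]
  have h := addChar_neg_mul χ c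
  congr 1
  · simp
  · simp [← mul_assoc]
  · simp
  · simp

/-- Only `u` and `c` can be recovered: if `χ` is trivial, the map depends on `a + b` alone. -/
theorem affPerm_eq_iff_left {u u' : (ZMod e)ˣ} {a a' b b' : ZMod e} {c c' : ZMod d}
    (h : affPerm χ u a b c = affPerm χ u' a' b' c') : u = u' ∧ c = c' := by
  have h0 := DFunLike.congr_fun h (0, 0)
  have h1 := DFunLike.congr_fun h (1, 0)
  simp only [affPerm_apply, Prod.mk.injEq] at h0 h1
  refine ⟨Units.ext ?_, ?_⟩
  · linear_combination h1.1 - h0.1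
  · simpa using h0.2

/-- The group of permutations `(x, t) ↦ (u x + b + a χ(t), t + c)`. -/
def affGroup : Subgroup (Perm (ZMod e × ZMod d)) where
  carrier := {π | ∃ u a b c, π = affPerm χ u a b c}
  mul_mem' := by
    rintro _ _ ⟨u, a, b, c, rfl⟩ ⟨u', a', b', c', rfl⟩
    exact ⟨_, _, _, _, affPerm_mul ..⟩
  one_mem' := ⟨1, 0, 0, 0, (affPerm_one χ).symm⟩
  inv_mem' := by
    rintro _ ⟨u, a, b, c, rfl⟩
    exact ⟨_, _, _, _, affPerm_inv ..⟩

theorem affPerm_mem (u : (ZMod e)ˣ) (a b : ZMod e) (c : ZMod d) :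
    affPerm χ u a b c ∈ affGroup χ := ⟨u, a, b, c, rfl⟩

variable {χ}

theorem isUnit_of_forall_mul_eq_zero {R : Type*} [CommRing R] [Finite R] {a : R}
    (h : ∀ y, a * y = 0 → y = 0) : IsUnit a := by
  have hinj : Function.Injective (a * ·) := by
    intro x y hxy
    exact sub_eq_zero.mp (h _ (by simpa [mul_sub, sub_eq_zero] using hxy))
  obtain ⟨y, hy⟩ := (Finite.injective_iff_surjective.mp hinj) 1
  exact IsUnit.of_mul_eq_one y hy

theorem eq_zero_of_nsmul_eq_zero {A : Type*} [AddGroup A] {n : ℕ}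
    (h : (Nat.card A).Coprime n) {a : A} (ha : n • a = 0) : a = 0 := by
  rw [← AddMonoid.addOrderOf_eq_one_iff]
  exact Nat.eq_one_of_dvd_coprimes h (addOrderOf_dvd_natCard a) (addOrderOf_dvd_of_nsmul_eq_zero ha)

variable {G : Type*} [Group G] {E : G ≃ ZMod e × ZMod d}

theorem IsCoords.symm_mul (hE : IsCoords χ E) (p q : ZMod e × ZMod d) :
    E.symm p * E.symm q = E.symm (p.1 + χ p.2 * q.1, p.2 + q.2) := by
  rw [← E.apply_eq_iff_eq, hE]; simp

/-- The map factors as the automorphism `(x, t) ↦ (u x + b (1 - χ(t)), t)`, a scaling plus a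
coboundary, followed by right multiplication by `(a + b, c)`. The inverse inside `rho` cancels the
one in its definition. -/
theorem IsCoords.affPerm_mem_map (hE : IsCoords χ E) (u : (ZMod e)ˣ) (a b : ZMod e) (c : ZMod d) :
    affPerm χ u a b c ∈ (Hol G).map E.permCongrHom.toMonoidHom := by
  let φ : MulAut G := MulEquiv.mk' (E.permCongr.symm (affPerm χ u (-b) b 0)) (by
    intro g h
    have key : ∀ g, E.permCongr.symm (affPerm χ u (-b) b 0) g =
      E.symm (affPerm χ u (-b) b 0 (E g)) := fun _ => rfl
    rw [key, key, key, hE.symm_mul, hE]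
    obtain ⟨x, t⟩ := E g
    obtain ⟨y, s⟩ := E h
    congr 1
    ext
    · simp only [affPerm_apply, AddChar.map_add_eq_mul, add_zero]; ring
    · simp)
  have h1 : affPerm χ u a b c =
      E.permCongrHom (rho G (E.symm (a + b, c))⁻¹ * MulAut.toPerm G φ) := by
    ext ⟨x, t⟩ : 1
    have : E.permCongrHom (rho G (E.symm (a + b, c))⁻¹ * MulAut.toPerm G φ) (x, t) =
        E (E.symm (affPerm χ u (-b) b 0 (E (E.symm (x, t)))) * ((E.symm (a + b, c))⁻¹)⁻¹) := rfl
    rw [this, inv_inv, hE.symm_mul]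
    simp only [apply_symm_apply, affPerm_apply, add_zero]
    ext
    · simp only; ring
    · simp
  rw [h1]
  exact Subgroup.mem_map_of_mem _ (mul_mem
    ((le_sup_left : (rho G).range ≤ Hol G) ⟨_, rfl⟩)
    ((le_sup_right : (MulAut.toPerm G).range ≤ Hol G) ⟨_, rfl⟩))

variable [NeZero d] [NeZero e]

/-- The automorphisms of a group with coordinates. -/
theorem IsCoords.exists_affPerm (hE : IsCoords χ E) (hcop : d.Coprime e)
    (hχ : Function.Injective χ) (φ : MulAut G) :
    ∃ u a b c, E.permCongr (MulAut.toPerm G φ) = affPerm χ u a b c := by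
  have hdu : IsUnit (d : ZMod e) := (ZMod.isUnit_iff_coprime d e).mpr hcop
  set F : ZMod e × ZMod d → ZMod e × ZMod d := fun p => E (φ (E.symm p)) with hF
  have hmul : ∀ p q : ZMod e × ZMod d, F (p.1 + χ p.2 * q.1, p.2 + q.2) =
      ((F p).1 + χ (F p).2 * (F q).1, (F p).2 + (F q).2) := by
    intro p q
    simp only [hF, ← hE.symm_mul, map_mul, hE (φ _)]
  have hinj : Function.Injective F := by
    intro p q hpq
    simpa [hF] using hpq
  have h0 : F (0, 0) = (0, 0) := by
    have h := hmul (0, 0) (0, 0)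
    simp only [mul_zero, add_zero] at h
    have h2 : (F (0, 0)).2 = 0 := by simpa using congrArg Prod.snd h
    have h1 : (F (0, 0)).1 = 0 := by
      have := congrArg Prod.fst h
      rw [h2] at this
      simpa using this
    exact Prod.ext h1 h2
  have hsnd : ∀ x y, (F (x + y, 0)).2 = (F (x, 0)).2 + (F (y, 0)).2 := by
    intro x y
    have h := hmul (x, 0) (y, 0)
    simp only [AddChar.map_zero_eq_one, one_mul, add_zero] at h
    rw [h]
  have hsnd' : ∀ (n : ℕ) x, (F (n • x, 0)).2 = n • (F (x, 0)).2 := by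
    intro n x
    induction n with
    | zero => simp [h0]
    | succ n ih => rw [succ_nsmul, hsnd, ih, succ_nsmul]
  -- The second coordinate restricts to a homomorphism `ZMod e → ZMod d`, which vanishes since the
  -- orders are coprime.
  have hx2 : ∀ x, (F (x, 0)).2 = 0 := by
    intro x
    apply eq_zero_of_nsmul_eq_zero (n := e) (by rwa [Nat.card_zmod])
    rw [← hsnd']
    simp [h0]
  have hfst : ∀ x y, (F (x + y, 0)).1 = (F (x, 0)).1 + (F (y, 0)).1 := by
    intro x y
    have h := hmul (x, 0) (y, 0)
    simp only [AddChar.map_zero_eq_one, one_mul, add_zero, hx2] at h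
    rw [h]
  have hx1 : ∀ x, (F (x, 0)).1 = (F (1, 0)).1 * x := by
    intro x
    have : ∀ n : ℕ, (F ((n : ZMod e), 0)).1 = (F (1, 0)).1 * n := by
      intro n
      induction n with
      | zero => simp [h0]
      | succ n ih => rw [Nat.cast_succ, hfst, ih]; ring
    simpa using this x.val
  obtain ⟨u, hu⟩ : IsUnit (F (1, 0)).1 := by
    apply isUnit_of_forall_mul_eq_zero
    intro y hy
    rw [← hx1] at hy
    have : F (y, 0) = F (0, 0) := by rw [h0]; exact Prod.ext hy (hx2 y)
    exact congrArg Prod.fst (hinj this)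
  have hx : ∀ x, F (x, 0) = (u * x, 0) := fun x => Prod.ext (by rw [hx1, hu]) (hx2 x)
  have hsplit : ∀ x t, F (x, t) = (u * x + (F (0, t)).1, (F (0, t)).2) := by
    intro x t
    have h := hmul (x, 0) (0, t)
    simp only [mul_zero, add_zero, zero_add, hx, AddChar.map_zero_eq_one, one_mul] at h
    exact h
  have hsplit' : ∀ x t, F (χ t * x, t) = ((F (0, t)).1 + χ (F (0, t)).2 * (u * x), (F (0, t)).2) := by
    intro x t
    have h := hmul (0, t) (x, 0)
    simp only [add_zero, zero_add, hx] at h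
    exact h
  -- Comparing the two ways of splitting off the normal factor shows that `t` and its image act
  -- alike; injectivity of `χ` concludes.
  have hS : ∀ t, (F (0, t)).2 = t := by
    intro t
    apply hχ
    have h := hsplit' (↑u⁻¹) t
    rw [hsplit] at h
    have h1 := congrArg Prod.fst h
    simp only at h1
    have h4 : (u : ZMod e) * ↑u⁻¹ = 1 := u.mul_inv
    linear_combination -h1 + (χ t - χ (F (0, t)).2) * h4
  have hA : ∀ t s, (F (0, t + s)).1 = (F (0, t)).1 + χ t * (F (0, s)).1 := by
    intro t s
    have h := congrArg Prod.fst (hmul (0, t) (0, s))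
    simp only [mul_zero, add_zero, hS] at h
    exact h
  -- The first coordinate on the complement is a 1-cocycle; averaging with `ψ = 1` makes it affine
  -- in `χ`, as `d` is invertible modulo `e`.
  obtain ⟨a, b, hab⟩ := exists_affine_of_shift hdu (1 : AddChar (ZMod d) (ZMod e)) χ 0 1
    (by simp) (fun t => (F (0, t)).1) (fun c => ⟨(F (0, c)).1, 0, fun t => by
      simp only [hA, AddChar.one_apply]; ring⟩)
  refine ⟨u, a, b, 0, ?_⟩
  ext ⟨x, t⟩ : 1
  change F (x, t) = _
  rw [hsplit, hS, affPerm_apply]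
  rw [hab]
  ext
  · simp only; ring
  · simp

/-- In coordinates, the holomorph is the group of affine permutations. -/
theorem IsCoords.map_hol (hE : IsCoords χ E) (hcop : d.Coprime e)
    (hχ : Function.Injective χ) :
    (Hol G).map E.permCongrHom.toMonoidHom = affGroup χ := by
  apply le_antisymm
  · rw [Hol, Subgroup.map_sup]
    refine sup_le ?_ ?_
    · rintro _ ⟨_, ⟨g, rfl⟩, rfl⟩
      refine ⟨1, (E g⁻¹).1, 0, (E g⁻¹).2, ?_⟩
      ext ⟨x, t⟩ : 1
      have : E.permCongrHom.toMonoidHom (rho G g) (x, t) = E (E.symm (x, t) * g⁻¹) := rfl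
      rw [this, hE]
      simp [mul_comm]
    · rintro _ ⟨_, ⟨φ, rfl⟩, rfl⟩
      exact hE.exists_affPerm hcop hχ φ
  · rintro _ ⟨u, a, b, c, rfl⟩
    exact hE.affPerm_mem_map u a b c

end Affine

/-! ### The shape of normalizing permutations -/

section Normalizer

variable {d e : ℕ} {χ : AddChar (ZMod d) (ZMod e)}

theorem exists_affPerm_of_mem_normalizer {π : Perm (ZMod e × ZMod d)}
    (hπ : π ∈ Subgroup.normalizer (affGroup χ : Set (Perm (ZMod e × ZMod d))))
    (u : (ZMod e)ˣ) (a b : ZMod e) (c : ZMod d) :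
    ∃ u' a' b' c', π * affPerm χ u a b c = affPerm χ u' a' b' c' * π := by
  obtain ⟨u', a', b', c', h⟩ := (Subgroup.mem_normalizer_iff.mp hπ _).mp (affPerm_mem χ u a b c)
  exact ⟨u', a', b', c', by rw [← h]; group⟩

theorem exists_affPerm_of_mem_normalizer' {π : Perm (ZMod e × ZMod d)}
    (hπ : π ∈ Subgroup.normalizer (affGroup χ : Set (Perm (ZMod e × ZMod d))))
    (u : (ZMod e)ˣ) (a b : ZMod e) (c : ZMod d) :
    ∃ u' a' b' c', π * affPerm χ u' a' b' c' = affPerm χ u a b c * π := by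
  obtain ⟨u', a', b', c', h⟩ := (Subgroup.mem_normalizer_iff''.mp hπ _).mp (affPerm_mem χ u a b c)
  exact ⟨u', a', b', c', by rw [← h]; group⟩

theorem affPerm_pow (u : (ZMod e)ˣ) (a b : ZMod e) (c : ZMod d) (n : ℕ) :
    ∃ a' b', affPerm χ u a b c ^ n = affPerm χ (u ^ n) a' b' (n • c) := by
  induction n with
  | zero => exact ⟨0, 0, by simp [affPerm_one]⟩
  | succ n ih =>
    obtain ⟨a', b', h⟩ := ih
    rw [pow_succ', h, affPerm_mul, ← pow_succ', ← succ_nsmul]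
    exact ⟨_, _, rfl⟩

theorem affPerm_translation_pow (n : ℕ) :
    affPerm χ 1 0 1 0 ^ n = affPerm χ 1 0 n 0 := by
  induction n with
  | zero => simp [affPerm_one]
  | succ n ih =>
    rw [pow_succ', ih, affPerm_mul]
    congr 1 <;> simp

theorem pow_eq_self_of_sq_eq_one {M : Type*} [Monoid M] {u : M} (hu : u ^ 2 = 1) {n : ℕ}
    (hn : Odd n) : u ^ n = u := by
  obtain ⟨j, rfl⟩ := hn
  rw [pow_succ, pow_mul, hu, one_pow, one_mul]

/-- In a ring `ZMod (2 * m)`, units fix the element `m`. -/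
theorem unit_mul_half {m : ℕ} (u : (ZMod (2 * m))ˣ) : (u : ZMod (2 * m)) * m = m := by
  have hcop : Nat.Coprime (u : ZMod (2 * m)).val (2 * m) := ZMod.val_coe_unit_coprime u
  obtain ⟨j, hj⟩ := (Nat.Coprime.odd_of_right (Nat.Coprime.coprime_mul_right_right hcop))
  rcases Nat.eq_zero_or_pos m with rfl | hm
  · simp
  have : NeZero (2 * m) := ⟨by omega⟩
  have h2 : ((2 * m : ℕ) : ZMod (2 * m)) = 0 := ZMod.natCast_self _
  rw [← ZMod.natCast_zmod_val (u : ZMod (2 * m)), hj]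
  push_cast at h2 ⊢
  linear_combination (j : ZMod (2 * m)) * h2

/-- Elements of the normalizer conjugate the translation `(x, t) ↦ (x + 1, t)` to a map that
fixes the second coordinate and has linear part `1`. -/
theorem exists_translation_conj [NeZero e] (hcop : d.Coprime e) (he : Squarefree e)
    {π : Perm (ZMod e × ZMod d)}
    (hπ : π ∈ Subgroup.normalizer (affGroup χ : Set (Perm (ZMod e × ZMod d)))) :
    ∃ a b, π * affPerm χ 1 0 1 0 = affPerm χ 1 a b 0 * π := by
  obtain ⟨u, a, b, c, h⟩ := exists_affPerm_of_mem_normalizer hπ 1 0 1 0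
  have hpow : ∀ n : ℕ, π * affPerm χ 1 0 n 0 = affPerm χ u a b c ^ n * π := by
    intro n
    rw [← affPerm_translation_pow]
    have : SemiconjBy π (affPerm χ 1 0 1 0) (affPerm χ u a b c) := h
    exact this.pow_right n
  have hone : affPerm χ u a b c ^ e = affPerm χ 1 0 0 0 := by
    have h1 := hpow e
    rw [ZMod.natCast_self, affPerm_one, mul_one] at h1
    rw [affPerm_one]
    exact mul_eq_right.mp h1.symm
  obtain ⟨a', b', h1⟩ := affPerm_pow (χ := χ) u a b c e
  obtain ⟨hue, hce⟩ := affPerm_eq_iff_left χ (h1.symm.trans hone)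
  have hc : c = 0 := eq_zero_of_nsmul_eq_zero (n := e) (by rwa [Nat.card_zmod]) hce
  subst hc
  -- The translation `T` and the map `N : x ↦ -x` satisfy `T N T = N`. Conjugating by `π` and
  -- comparing linear parts, which commute, gives `u ^ 2 = 1`.
  have hu2 : u ^ 2 = 1 := by
    obtain ⟨u₁, a₁, b₁, c₁, hN⟩ := exists_affPerm_of_mem_normalizer hπ (-1) 0 0 0
    have h2 : affPerm χ 1 0 1 0 * affPerm χ (-1) 0 0 0 * affPerm χ 1 0 1 0 =
        affPerm χ (-1) 0 0 0 := by
      rw [affPerm_mul, affPerm_mul]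
      congr 1 <;> simp
    have h3 : affPerm χ u a b 0 * affPerm χ u₁ a₁ b₁ c₁ * affPerm χ u a b 0 =
        affPerm χ u₁ a₁ b₁ c₁ := by
      apply mul_right_cancel (b := π)
      rw [← hN, ← h2, mul_assoc, ← h, ← mul_assoc, mul_assoc _ _ π, ← hN, ← mul_assoc, ← h]
      simp only [mul_assoc]
    rw [affPerm_mul, affPerm_mul] at h3
    have h4 := (affPerm_eq_iff_left χ h3).1
    have h5 : u₁ * u ^ 2 = u₁ * 1 := by
      rw [mul_one]; nth_rewrite 2 [← h4]; rw [pow_two, mul_right_comm, mul_comm, mul_assoc]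
    exact mul_left_cancel h5
  -- For odd `e`, use `u ^ e = 1`. For `e = 2 m`, `m` is odd by squarefreeness, so the conjugate of
  -- `T ^ m` has linear part `u ^ m = u`. Translation by `m` commutes with the preimage of `T` under
  -- conjugation, because units fix `m`; so the conjugate commutes with `T`, forcing `u = 1`.
  have hu : u = 1 := by
    rcases Nat.even_or_odd' e with ⟨m, hm | hm⟩
    · subst hm
      have hmodd : ¬ 2 ∣ m := by
        rintro ⟨n, rfl⟩
        have := he 2 ⟨n, by ring⟩
        simp at this
      have hum : u ^ m = u := by
        apply pow_eq_self_of_sq_eq_one hu2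
        rwa [← Nat.not_even_iff_odd, even_iff_two_dvd]
      obtain ⟨a₂, b₂, h2⟩ := affPerm_pow (χ := χ) u a b 0 m
      rw [hum, smul_zero] at h2
      have h3 := hpow m
      rw [h2] at h3
      obtain ⟨u₁, a₁, b₁, c₁, hN⟩ := exists_affPerm_of_mem_normalizer' hπ 1 0 1 0
      have hcentral : affPerm χ u₁ a₁ b₁ c₁ * affPerm χ 1 0 (m : ZMod (2 * m)) 0 =
          affPerm χ 1 0 (m : ZMod (2 * m)) 0 * affPerm χ u₁ a₁ b₁ c₁ := by
        rw [affPerm_mul, affPerm_mul]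
        congr 1
        · simp
        · simp
        · rw [unit_mul_half]; simp [add_comm]
        · simp
      have h4 : affPerm χ 1 0 1 0 * affPerm χ u a₂ b₂ 0 =
          affPerm χ u a₂ b₂ 0 * affPerm χ 1 0 1 0 := by
        apply mul_right_cancel (b := π)
        rw [mul_assoc, ← h3, ← mul_assoc, ← hN, mul_assoc, hcentral, ← mul_assoc, h3, mul_assoc,
          hN, mul_assoc]
      have h5 := congrArg Prod.fst (DFunLike.congr_fun h4 (0, 0))
      simp only [Perm.mul_apply, affPerm_apply, Units.val_one] at h5
      ext
      rw [Units.val_one]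
      simp only [AddChar.map_zero_eq_one, add_zero] at h5
      linear_combination -h5
    · rwa [pow_eq_self_of_sq_eq_one hu2 ⟨m, hm⟩] at hue
  subst hu
  exact ⟨a, b, h⟩

/-- The shape of the elements of the normalizer. -/
theorem exists_form_of_mem_normalizer [NeZero d] [NeZero e] (hcop : d.Coprime e)
    (he : Squarefree e) {π : Perm (ZMod e × ZMod d)}
    (hπ : π ∈ Subgroup.normalizer (affGroup χ : Set (Perm (ZMod e × ZMod d)))) :
    ∃ (u : (ZMod e)ˣ) (c v : ZMod d) (ψ : AddChar (ZMod d) (ZMod e)) (β : ZMod d → ZMod e),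
      (∀ x t, π (x, t) = (β t + u * ψ t * x, v * t + c)) ∧
      (∃ A B, ∀ t, ψ t = B + A * χ (v * t)) ∧
      (∃ A B, ∀ t, ψ t * χ t = B + A * χ (v * t)) ∧
      ∀ s, ∃ a b, ∀ t, β (t + s) = ψ s * β t + b + a * χ (v * t) := by
  obtain ⟨A, B, hT⟩ := exists_translation_conj hcop he hπ
  set β : ZMod d → ZMod e := fun t => (π (0, t)).1 with hβ
  set p : ZMod d → ZMod d := fun t => (π (0, t)).2 with hp
  set α : ZMod d → ZMod e := fun t => B + A * χ (p t) with hα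
  -- Each unit step in `x` adds `B + A χ(p t)` and leaves the second coordinate alone, so `π` is
  -- affine along each fibre.
  have hform : ∀ x t, π (x, t) = (β t + α t * x, p t) := by
    intro x t
    have hn : ∀ n : ℕ, π ((n : ZMod e), t) = (β t + α t * n, p t) := by
      intro n
      induction n with
      | zero => ext <;> simp [hβ, hp]
      | succ n ih =>
        have h := DFunLike.congr_fun hT ((n : ZMod e), t)
        simp only [Perm.mul_apply, affPerm_apply, ih, Units.val_one, one_mul, zero_mul,
          add_zero] at h
        rw [Nat.cast_succ, h]
        ext
        · simp only [hα]; ring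
        · rfl
    simpa using hn x.val
  have hunit : ∀ t, IsUnit (α t) := by
    intro t
    apply isUnit_of_forall_mul_eq_zero
    intro y hy
    have h : π (y, t) = π (0, t) := by rw [hform, hform, hy, mul_zero]
    exact congrArg Prod.fst (π.injective h)
  have hshift : ∀ s, ∃ (u : (ZMod e)ˣ) (a b : ZMod e) (c : ZMod d),
      (∀ t, p (t + s) = p t + c) ∧ (∀ t, α (t + s) = u * α t) ∧
      ∀ t, β (t + s) = u * β t + b + a * χ (p t) := by
    intro s
    obtain ⟨u, a, b, c, h⟩ := exists_affPerm_of_mem_normalizer hπ 1 0 0 s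
    have h' : ∀ x t, (β (t + s) + α (t + s) * x, p (t + s)) =
        (u * (β t + α t * x) + b + a * χ (p t), p t + c) := by
      intro x t
      have h1 := DFunLike.congr_fun h (x, t)
      simp only [Perm.mul_apply, affPerm_apply, Units.val_one, one_mul, zero_mul, add_zero,
        hform] at h1
      exact h1
    refine ⟨u, a, b, c, fun t => congrArg Prod.snd (h' 0 t), fun t => ?_, fun t => ?_⟩
    · have h0 := congrArg Prod.fst (h' 0 t)
      have h1 := congrArg Prod.fst (h' 1 t)
      simp only at h0 h1
      linear_combination h1 - h0
    · have h0 := congrArg Prod.fst (h' 0 t)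
      simp only at h0
      linear_combination h0
  choose w a b c hpc hαw hβw using hshift
  have hc : ∀ s, c s = p s - p 0 := fun s => by
    rw [eq_sub_iff_add_eq, add_comm, ← hpc, zero_add]
  obtain ⟨u, hu⟩ := hunit 0
  have hw : ∀ s, (w s : ZMod e) = ↑u⁻¹ * α s := fun s => by
    have h := hαw s 0
    rw [zero_add, ← hu] at h
    linear_combination ↑u⁻¹ * (-h) - (w s : ZMod e) * u.inv_mul
  -- The slope normalized by its value at `0`, that is `α(s) / α(0)`; the shift relation makes it
  -- multiplicative.
  let ψ : AddChar (ZMod d) (ZMod e) :=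
    { toFun := fun s => w s
      map_zero_eq_one' := by rw [hw, ← hu, u.inv_mul]
      map_add_eq_mul' := fun s t => by
        rw [hw (s + t), hαw t s, hw s]; ring }
  have hψ : ∀ s, ψ s = w s := fun s => rfl
  let L : ZMod d →+ ZMod d := AddMonoidHom.mk' (fun t => p t - p 0) (fun t s => by
    rw [hpc s t, hc s]; ring)
  have hL : ∀ t, p t = L 1 * t + p 0 := by
    intro t
    have h1 : L t = L 1 * t := by
      have h2 := map_nsmul L t.val 1
      rw [nsmul_one, ZMod.natCast_zmod_val, nsmul_eq_mul, ZMod.natCast_zmod_val] at h2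
      rw [h2, mul_comm]
    rw [← h1]
    change p t = p t - p 0 + p 0
    ring
  have hχp : ∀ t, χ (p t) = χ (p 0) * χ (L 1 * t) := fun t => by
    rw [hL t, AddChar.map_add_eq_mul, mul_comm]
  refine ⟨u, p 0, L 1, ψ, β, ?_, ?_, ?_, ?_⟩
  · intro x t
    rw [hform, ← hL, hψ, hw]
    congr 1
    linear_combination (-α t * x) * u.mul_inv
  · refine ⟨↑u⁻¹ * A * χ (p 0), ↑u⁻¹ * B, fun t => ?_⟩
    rw [hψ, hw]
    simp only [hα]
    rw [hχp]; ring
  -- Conjugating `(x, t) ↦ (x + χ(t), t)` gives the condition on `ψ χ`, once its linear part is seen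
  -- to be `1`.
  · obtain ⟨u', a', b', c', h⟩ := exists_affPerm_of_mem_normalizer hπ 1 1 0 0
    have h' : ∀ x t, β t + α t * (x + χ t) = u' * (β t + α t * x) + b' + a' * χ (p t) := by
      intro x t
      have h1 := congrArg Prod.fst (DFunLike.congr_fun h (x, t))
      simp only [Perm.mul_apply, affPerm_apply, Units.val_one, one_mul, add_zero,
        hform] at h1
      exact h1
    have hu' : (u' : ZMod e) = 1 := by
      have h1 := h' 1 0
      have h0 := h' 0 0
      rw [← hu] at h1 h0
      linear_combination ↑u⁻¹ * (h0 - h1) - (u' - 1 : ZMod e) * u.inv_mul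
    refine ⟨↑u⁻¹ * a' * χ (p 0), ↑u⁻¹ * b', fun t => ?_⟩
    have h0 := h' 0 t
    rw [hu', hχp] at h0
    rw [hψ, hw]
    linear_combination ↑u⁻¹ * h0
  · intro s
    refine ⟨a s * χ (p 0), b s, fun t => ?_⟩
    rw [hβw, hψ, hχp]; ring

end Normalizer

/-! ### Twists, one prime at a time -/

section Twist

variable {d e : ℕ} {χ : AddChar (ZMod d) (ZMod e)}

theorem dvd_of_forall_prime_dvd {e n : ℕ} (he : Squarefree e)
    (h : ∀ q, q.Prime → q ∣ e → q ∣ n) : e ∣ n := by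
  rw [← Nat.prod_primeFactors_of_squarefree he]
  exact Finset.prod_primes_dvd _ (fun q hq => (Nat.prime_of_mem_primeFactors hq).prime)
    fun q hq => h q (Nat.prime_of_mem_primeFactors hq) (Nat.dvd_of_mem_primeFactors hq)

/-- For squarefree `e`, `ZMod e` embeds in the product of its residue fields, so identities between
characters may be checked over fields. -/
theorem eq_of_forall_castHom_eq [NeZero e] (he : Squarefree e) {x y : ZMod e}
    (h : ∀ q, q.Prime → ∀ hq : q ∣ e, ZMod.castHom hq (ZMod q) x = ZMod.castHom hq (ZMod q) y) :
    x = y := by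
  rw [← sub_eq_zero, ← ZMod.natCast_zmod_val (x - y), ZMod.natCast_eq_zero_iff]
  refine dvd_of_forall_prime_dvd he fun q hq hqe => ?_
  rw [← ZMod.natCast_eq_zero_iff, ← map_natCast (ZMod.castHom hqe (ZMod q)),
    ZMod.natCast_zmod_val, map_sub, h q hq hqe, sub_self]

/-- The idempotent of `ZMod e` which is `1` modulo the primes satisfying `P` and `0` modulo the
others. -/
theorem exists_indicator {e : ℕ} (he : Squarefree e) (P : ℕ → Prop) [DecidablePred P] :
    ∃ ε : ZMod e, ∀ q, q.Prime → ∀ hq : q ∣ e,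
      ZMod.castHom hq (ZMod q) ε = if P q then 1 else 0 := by
  have hcop : Nat.Coprime (∏ q ∈ e.primeFactors with P q, q)
      (∏ q ∈ e.primeFactors with ¬ P q, q) := by
    refine Nat.Coprime.prod_left fun p hp => Nat.Coprime.prod_right fun q hq => ?_
    rw [Finset.mem_filter] at hp hq
    rw [Nat.coprime_primes (Nat.prime_of_mem_primeFactors hp.1)
      (Nat.prime_of_mem_primeFactors hq.1)]
    rintro rfl
    exact hq.2 hp.2
  obtain ⟨n, h1, h2⟩ := Nat.chineseRemainder hcop 1 0
  refine ⟨n, fun q hq hqe => ?_⟩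
  have hmem : q ∈ e.primeFactors := Nat.mem_primeFactors.mpr ⟨hq, hqe, he.ne_zero⟩
  rw [map_natCast]
  split_ifs with hP
  · have h3 : n ≡ 1 [MOD q] :=
      h1.of_dvd (Finset.dvd_prod_of_mem (fun q => q) (Finset.mem_filter.mpr ⟨hmem, hP⟩))
    simpa using (ZMod.natCast_eq_natCast_iff _ _ _).mpr h3
  · have h3 : n ≡ 0 [MOD q] :=
      h2.of_dvd (Finset.dvd_prod_of_mem (fun q => q) (Finset.mem_filter.mpr ⟨hmem, hP⟩))
    simpa using (ZMod.natCast_eq_natCast_iff _ _ _).mpr h3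

/-- Modulo each prime divisor of `e`, either `ψ` is trivial and multiplication by `v` fixes `χ`, or
`ψ` is the inverse of `χ` and multiplication by `v` inverts `χ`. -/
def IsTwist (χ ψ : AddChar (ZMod d) (ZMod e)) (v : ZMod d) : Prop :=
  ∀ q, q.Prime → ∀ hq : q ∣ e,
    (∀ t, ZMod.castHom hq (ZMod q) (ψ t) = 1 ∧
      ZMod.castHom hq (ZMod q) (χ (v * t)) = ZMod.castHom hq (ZMod q) (χ t)) ∨
    (∀ t, ZMod.castHom hq (ZMod q) (ψ t) * ZMod.castHom hq (ZMod q) (χ t) = 1 ∧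
      ZMod.castHom hq (ZMod q) (χ (v * t)) * ZMod.castHom hq (ZMod q) (χ t) = 1)

theorem addChar_eq_pow {R : Type*} [CommMonoid R] [NeZero d] (ψ : AddChar (ZMod d) R) (t : ZMod d) :
    ψ t = ψ 1 ^ t.val := by
  rw [← AddChar.map_nsmul_eq_pow, nsmul_one, ZMod.natCast_zmod_val]

theorem addChar_mul_eq_pow {R : Type*} [CommMonoid R] [NeZero d] (ψ : AddChar (ZMod d) R)
    (v t : ZMod d) : ψ (v * t) = ψ v ^ t.val := by
  rw [← AddChar.map_nsmul_eq_pow, nsmul_eq_mul, ZMod.natCast_zmod_val, mul_comm]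

/-- It suffices to check the defining condition of a twist at `1`. -/
theorem isTwist_of_one [NeZero d] {ψ : AddChar (ZMod d) (ZMod e)} {v : ZMod d}
    (h : ∀ q, q.Prime → ∀ hq : q ∣ e,
      (ZMod.castHom hq (ZMod q) (ψ 1) = 1 ∧
        ZMod.castHom hq (ZMod q) (χ v) = ZMod.castHom hq (ZMod q) (χ 1)) ∨
      (ZMod.castHom hq (ZMod q) (ψ 1) * ZMod.castHom hq (ZMod q) (χ 1) = 1 ∧
        ZMod.castHom hq (ZMod q) (χ v) * ZMod.castHom hq (ZMod q) (χ 1) = 1)) :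
    IsTwist χ ψ v := by
  intro q hq hqe
  refine (h q hq hqe).imp (fun h1 t => ?_) (fun h1 t => ?_)
  · rw [addChar_eq_pow ψ, addChar_mul_eq_pow, addChar_eq_pow χ t, map_pow, map_pow, map_pow, h1.1,
      h1.2, one_pow]
    exact ⟨rfl, rfl⟩
  · rw [addChar_eq_pow ψ, addChar_mul_eq_pow, addChar_eq_pow χ t, map_pow, map_pow, map_pow,
      ← mul_pow, ← mul_pow, h1.1, h1.2, one_pow]
    exact ⟨rfl, rfl⟩

/-- Independence of characters in explicit form: eliminating `A` and `B` from three consecutive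
values leaves `(X - 1)(X - K) = 0`. -/
theorem eq_one_or_eq_of_affine {F : Type*} [Field F] {X K A B : F} (h0 : 1 = B + A)
    (h1 : X = B + A * K) (h2 : X ^ 2 = B + A * K ^ 2) : X = 1 ∨ X = K := by
  have h : (X - 1) * (X - K) = 0 := by
    linear_combination h2 + K * h0 - (1 + K) * h1
  rcases mul_eq_zero.mp h with h | h
  · exact Or.inl (sub_eq_zero.mp h)
  · exact Or.inr (sub_eq_zero.mp h)

/-- Modulo `q`, each of `ψ` and `ψ χ` is `1` or `χ(v ·)`. The mixed cases are the two alternatives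
of a twist; in the other two cases `χ` is trivial modulo `q`, and the first alternative holds. -/
theorem isTwist_of_affine [NeZero d] {ψ : AddChar (ZMod d) (ZMod e)} {v : ZMod d}
    (h1 : ∃ A B, ∀ t, ψ t = B + A * χ (v * t))
    (h2 : ∃ A B, ∀ t, ψ t * χ t = B + A * χ (v * t)) : IsTwist χ ψ v := by
  refine isTwist_of_one fun q hq hqe => ?_
  have := Fact.mk hq
  set φ := ZMod.castHom hqe (ZMod q)
  have hdich : ∀ ω : AddChar (ZMod d) (ZMod e), (∃ A B, ∀ t, ω t = B + A * χ (v * t)) →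
      φ (ω 1) = 1 ∨ φ (ω 1) = φ (χ v) := by
    rintro ω ⟨A, B, h⟩
    have e0 := congrArg φ (h 0)
    have e1 := congrArg φ (h 1)
    have e2 := congrArg φ (h (1 + 1))
    rw [mul_add, AddChar.map_add_eq_mul, AddChar.map_add_eq_mul] at e2
    simp only [mul_zero, AddChar.map_zero_eq_one, mul_one, map_one, map_add, map_mul] at e0 e1 e2
    exact eq_one_or_eq_of_affine e0 e1 (by rw [pow_two, pow_two]; exact e2)
  have hv : φ (χ v) = φ (χ 1) ^ v.val := by rw [addChar_eq_pow, map_pow]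
  have hne : φ (χ v) ≠ 0 := by
    have h := congrArg φ (addChar_mul_neg χ v)
    rw [map_mul, map_one] at h
    exact left_ne_zero_of_mul_eq_one h
  have h2' : φ (ψ 1) * φ (χ 1) = 1 ∨ φ (ψ 1) * φ (χ 1) = φ (χ v) := by
    have := hdich (ψ * χ) (by simpa [AddChar.mul_apply] using h2)
    simpa [AddChar.mul_apply] using this
  rcases hdich ψ h1 with hX | hX <;> rcases h2' with hY | hY
  · rw [hX, one_mul] at hY
    left
    rw [hX, hv, hY, one_pow]
    exact ⟨rfl, rfl⟩
  · rw [hX, one_mul] at hY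
    exact Or.inl ⟨hX, hY.symm⟩
  · exact Or.inr ⟨hY, hX ▸ hY⟩
  · rw [hX] at hY
    have hk : φ (χ 1) = 1 := by simpa [hne] using hY
    left
    rw [hX, hv, hk, one_pow]
    exact ⟨rfl, rfl⟩

namespace IsTwist

variable [NeZero e] {ψ : AddChar (ZMod d) (ZMod e)} {v : ZMod d}

/-- At each prime, multiplication by `v` fixes or inverts `χ`, so applying it twice does nothing to
`χ`, which is injective. -/
theorem mul_self (h : IsTwist χ ψ v) (he : Squarefree e) (hχ : Function.Injective χ) (t : ZMod d) :
    v * (v * t) = t := by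
  apply hχ
  refine eq_of_forall_castHom_eq he fun q hq hqe => ?_
  have := Fact.mk hq
  rcases h q hq hqe with h | h
  · rw [(h _).2, (h _).2]
  · have h1 := (h (v * t)).2
    have h2 := (h t).2
    exact mul_right_cancel₀ (right_ne_zero_of_mul_eq_one h1) (by rw [h1, mul_comm, h2])

theorem map_mul_mul (h : IsTwist χ ψ v) (he : Squarefree e) (t : ZMod d) :
    ψ (v * t) * ψ t = 1 := by
  refine eq_of_forall_castHom_eq he fun q hq hqe => ?_
  have := Fact.mk hq
  rw [map_mul, map_one]
  rcases h q hq hqe with h | h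
  · rw [(h _).1, (h _).1, one_mul]
  · have h1 := (h (v * t)).1
    have h2 := (h t).2
    have h3 := (h t).1
    have h4 := mul_right_cancel₀ (right_ne_zero_of_mul_eq_one h3) (h3.trans h2.symm)
    rw [h4, h1]

/-- The involution `(x, t) ↦ (ψ(t) x, v t)`. -/
def perm (h : IsTwist χ ψ v) (he : Squarefree e) (hχ : Function.Injective χ) :
    Perm (ZMod e × ZMod d) :=
  Function.Involutive.toPerm (fun p => (ψ p.2 * p.1, v * p.2)) (by
    rintro ⟨x, t⟩
    ext
    · simp only [← mul_assoc, h.map_mul_mul he, one_mul]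
    · simp only [h.mul_self he hχ])

@[simp] theorem perm_apply (h : IsTwist χ ψ v) (he : Squarefree e) (hχ : Function.Injective χ)
    (x : ZMod e) (t : ZMod d) : h.perm he hχ (x, t) = (ψ t * x, v * t) := rfl

theorem perm_mul_perm (h : IsTwist χ ψ v) (he : Squarefree e) (hχ : Function.Injective χ) :
    h.perm he hχ * h.perm he hχ = 1 := by
  ext ⟨x, t⟩
  · simp [← mul_assoc, h.map_mul_mul he]
  · simp [h.mul_self he hχ]

-- With `ε` the idempotent of the primes where the first alternative fails, precomposition with `v`
-- turns the pair `ψ`, `ψ χ` into `1`, `χ`, swapped at those primes. This keeps the span of `1` and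
-- `χ` stable under conjugation by a twist.
open Classical in
theorem exists_affine (h : IsTwist χ ψ v) (he : Squarefree e) :
    ∃ ε : ZMod e, (∀ t, ψ (v * t) = (1 - ε) + ε * χ t) ∧
      ∀ t, ψ (v * t) * χ (v * t) = ε + (1 - ε) * χ t := by
  obtain ⟨ε, hε⟩ := exists_indicator he (fun q => ∀ hq : q ∣ e, ¬ ∀ t,
    ZMod.castHom hq (ZMod q) (ψ t) = 1 ∧
      ZMod.castHom hq (ZMod q) (χ (v * t)) = ZMod.castHom hq (ZMod q) (χ t))
  have key : ∀ q, q.Prime → ∀ hq : q ∣ e,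
      (ZMod.castHom hq (ZMod q) ε = 0 ∧ ∀ t, ZMod.castHom hq (ZMod q) (ψ t) = 1 ∧
        ZMod.castHom hq (ZMod q) (χ (v * t)) = ZMod.castHom hq (ZMod q) (χ t)) ∨
      (ZMod.castHom hq (ZMod q) ε = 1 ∧
        ∀ t, ZMod.castHom hq (ZMod q) (ψ t) * ZMod.castHom hq (ZMod q) (χ t) = 1 ∧
        ZMod.castHom hq (ZMod q) (χ (v * t)) * ZMod.castHom hq (ZMod q) (χ t) = 1) := by
    intro q hq hqe
    by_cases hc : ∀ t, ZMod.castHom hqe (ZMod q) (ψ t) = 1 ∧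
      ZMod.castHom hqe (ZMod q) (χ (v * t)) = ZMod.castHom hqe (ZMod q) (χ t)
    · left
      refine ⟨?_, hc⟩
      rw [hε q hq hqe, if_neg]
      exact fun h1 => h1 hqe hc
    · right
      refine ⟨?_, (h q hq hqe).resolve_left hc⟩
      rw [hε q hq hqe, if_pos]
      exact fun _ => hc
  refine ⟨ε, fun t => ?_, fun t => ?_⟩ <;> refine eq_of_forall_castHom_eq he fun q hq hqe => ?_ <;>
    have := Fact.mk hq <;> simp only [map_add, map_mul, map_sub, map_one] <;>
    rcases key q hq hqe with ⟨h0, h1⟩ | ⟨h0, h1⟩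
  · rw [h0, (h1 _).1]; ring
  · have h2 := (h1 (v * t)).1
    have h3 := (h1 t).2
    rw [h0, sub_self, zero_add, one_mul]
    exact mul_right_cancel₀ (right_ne_zero_of_mul_eq_one h2) (by rw [h2, mul_comm, h3])
  · rw [h0, (h1 _).1, (h1 _).2]; ring
  · rw [h0, (h1 _).1]; ring

theorem perm_mem_normalizer (h : IsTwist χ ψ v) (he : Squarefree e) (hχ : Function.Injective χ) :
    h.perm he hχ ∈ Subgroup.normalizer (affGroup χ : Set (Perm (ZMod e × ZMod d))) := by
  have hinv : (h.perm he hχ)⁻¹ = h.perm he hχ := inv_eq_of_mul_eq_one_right (h.perm_mul_perm he hχ)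
  obtain ⟨ε, h1, h2⟩ := h.exists_affine he
  have hmem : ∀ f ∈ affGroup χ, h.perm he hχ * f * h.perm he hχ ∈ affGroup χ := by
    rintro _ ⟨u, a, b, c, rfl⟩
    have hw : ψ c * ψ (-c) = 1 := addChar_mul_neg ψ c
    -- The factor `ψ(c)` comes from the shift `c`; `ε` exchanges the roles of `a` and `b` at the
    -- inverted primes.
    refine ⟨Units.mk (ψ c) (ψ (-c)) hw (addChar_neg_mul ψ c) * u,
      ψ c * (b * ε + a * (1 - ε)), ψ c * (b * (1 - ε) + a * ε), v * c, ?_⟩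
    ext ⟨x, t⟩ : 1
    simp only [Perm.mul_apply, perm_apply, affPerm_apply, Units.val_mul]
    rw [mul_add v, h.mul_self he hχ, AddChar.map_add_eq_mul]
    congr 1
    linear_combination (ψ c * u * x) * h.map_mul_mul he t + ψ c * b * h1 t + ψ c * a * h2 t
  rw [Subgroup.mem_normalizer_iff]
  intro f
  rw [hinv]
  refine ⟨hmem f, fun hf => ?_⟩
  have := hmem _ hf
  have h3 := h.perm_mul_perm he hχ
  rwa [mul_assoc, mul_assoc, mul_assoc, h3, mul_one, ← mul_assoc, h3, one_mul] at this

end IsTwist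

/-- Since `ψ` is affine in `χ(v ·)`, averaging makes `β` affine in `χ(v ·)` too, and this part can
be absorbed into an affine map applied after the twist. -/
theorem exists_twist_of_mem_normalizer [NeZero d] [NeZero e] (hcop : d.Coprime e)
    (he : Squarefree e) (hχ : Function.Injective χ) {π : Perm (ZMod e × ZMod d)}
    (hπ : π ∈ Subgroup.normalizer (affGroup χ : Set (Perm (ZMod e × ZMod d)))) :
    ∃ (ψ : AddChar (ZMod d) (ZMod e)) (v : ZMod d) (h : IsTwist χ ψ v), ∃ f ∈ affGroup χ,
      π = f * h.perm he hχ := by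
  have hdu : IsUnit (d : ZMod e) := (ZMod.isUnit_iff_coprime d e).mpr hcop
  obtain ⟨u, c, v, ψ, β, hform, hψ, hψ', hβ⟩ := exists_form_of_mem_normalizer hcop he hπ
  obtain ⟨A, B, hAB⟩ := hψ
  obtain ⟨a, b, hab⟩ := exists_affine_of_shift hdu ψ (AddChar.mulShift χ v) A B
    (by simpa [AddChar.mulShift_apply] using hAB) β (by simpa [AddChar.mulShift_apply] using hβ)
  refine ⟨ψ, v, isTwist_of_affine ⟨A, B, hAB⟩ hψ', affPerm χ u a b c, affPerm_mem .., ?_⟩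
  ext ⟨x, t⟩ : 1
  rw [hform, hab, Perm.mul_apply, IsTwist.perm_apply, affPerm_apply, AddChar.mulShift_apply]
  congr 1
  ring

theorem twist_eq_of_mul_eq [NeZero e] (he : Squarefree e) (hχ : Function.Injective χ)
    {ψ ψ' : AddChar (ZMod d) (ZMod e)} {v v' : ZMod d} (h : IsTwist χ ψ v) (h' : IsTwist χ ψ' v')
    {f : Perm (ZMod e × ZMod d)} (hf : f ∈ affGroup χ) (heq : h'.perm he hχ = f * h.perm he hχ) :
    ψ' = ψ ∧ v' = v := by
  obtain ⟨u, a, b, c, rfl⟩ := hf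
  have hp : ∀ x t, ((ψ' t * x, v' * t) : ZMod e × ZMod d) =
      (u * (ψ t * x) + b + a * χ (v * t), v * t + c) := fun x t => DFunLike.congr_fun heq (x, t)
  have h2 : ∀ t, v' * t = v * t + c := fun t => congrArg Prod.snd (hp 0 t)
  have h1 : ∀ t, ψ' t = u * ψ t := fun t => by
    have e0 := congrArg Prod.fst (hp 0 t)
    have e1 := congrArg Prod.fst (hp 1 t)
    simp only at e0 e1
    linear_combination e1 - e0
  have hc : c = 0 := by simpa using (h2 0).symm
  have hu : (u : ZMod e) = 1 := by simpa using (h1 0).symm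
  refine ⟨?_, by simpa [hc] using h2 1⟩
  ext t
  rw [h1, hu, one_mul]

end Twist

/-! ### The quotient `T(G)`: exponent two and order -/

section Quotient

variable {d e : ℕ} [NeZero d] [NeZero e] {χ : AddChar (ZMod d) (ZMod e)}

theorem mul_self_mem_affGroup (hcop : d.Coprime e) (he : Squarefree e)
    (hχ : Function.Injective χ) {π : Perm (ZMod e × ZMod d)}
    (hπ : π ∈ Subgroup.normalizer (affGroup χ : Set (Perm (ZMod e × ZMod d)))) :
    π * π ∈ affGroup χ := by
  obtain ⟨ψ, v, h, f, hf, rfl⟩ := exists_twist_of_mem_normalizer hcop he hχ hπ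
  have h1 := (Subgroup.mem_normalizer_iff.mp (h.perm_mem_normalizer he hχ) f).mp hf
  have h2 : f * h.perm he hχ * (f * h.perm he hχ) =
      f * (h.perm he hχ * f * (h.perm he hχ)⁻¹) * (h.perm he hχ * h.perm he hχ) := by group
  rw [h2, h.perm_mul_perm he hχ, mul_one]
  exact mul_mem hf h1

/-- The twist involutions form a transversal: they meet every coset, and `twist_eq_of_mul_eq`
separates them. -/
theorem relIndex_affGroup (hcop : d.Coprime e) (he : Squarefree e) (hχ : Function.Injective χ) :
    (affGroup χ).relIndex (Subgroup.normalizer (affGroup χ : Set (Perm (ZMod e × ZMod d)))) =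
      Nat.card {p : AddChar (ZMod d) (ZMod e) × ZMod d // IsTwist χ p.1 p.2} := by
  set N := Subgroup.normalizer (affGroup χ : Set (Perm (ZMod e × ZMod d))) with hN
  let Φ : {p : AddChar (ZMod d) (ZMod e) × ZMod d // IsTwist χ p.1 p.2} →
      N ⧸ (affGroup χ).subgroupOf N :=
    fun p => QuotientGroup.mk ⟨p.2.perm he hχ, p.2.perm_mem_normalizer he hχ⟩
  symm
  refine Nat.card_eq_of_bijective Φ ⟨?_, ?_⟩
  · rintro ⟨⟨ψ, v⟩, h⟩ ⟨⟨ψ', v'⟩, h'⟩ heq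
    have h1 : (h.perm he hχ)⁻¹ * h'.perm he hχ ∈ affGroup χ :=
      Subgroup.mem_subgroupOf.mp (QuotientGroup.eq.mp heq)
    have h2 := (Subgroup.mem_normalizer_iff.mp (h.perm_mem_normalizer he hχ) _).mp h1
    obtain ⟨rfl, rfl⟩ := twist_eq_of_mul_eq he hχ h h' h2 (by group)
    rfl
  · intro x
    obtain ⟨⟨π, hπ⟩, rfl⟩ := QuotientGroup.mk_surjective x
    obtain ⟨ψ, v, h, f, hf, rfl⟩ := exists_twist_of_mem_normalizer hcop he hχ hπ
    refine ⟨⟨(ψ, v), h⟩, QuotientGroup.eq.mpr (Subgroup.mem_subgroupOf.mpr ?_)⟩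
    exact ((Subgroup.mem_normalizer_iff''.mp (h.perm_mem_normalizer he hχ) f).mp hf)

variable {G : Type*} [Group G] {E : G ≃ ZMod e × ZMod d}

theorem IsCoords.map_nHol (hE : IsCoords χ E) (hcop : d.Coprime e) (hχ : Function.Injective χ) :
    (NHol G).map E.permCongrHom.toMonoidHom =
      Subgroup.normalizer (affGroup χ : Set (Perm (ZMod e × ZMod d))) := by
  rw [NHol, Subgroup.map_equiv_normalizer_eq, hE.map_hol hcop hχ]

theorem IsCoords.card_T (hE : IsCoords χ E) (hcop : d.Coprime e) (he : Squarefree e)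
    (hχ : Function.Injective χ) :
    Nat.card (T G) = Nat.card {p : AddChar (ZMod d) (ZMod e) × ZMod d // IsTwist χ p.1 p.2} := by
  rw [← relIndex_affGroup hcop he hχ, ← hE.map_nHol hcop hχ, ← hE.map_hol hcop hχ,
    Subgroup.relIndex_map_map_of_injective _ _ E.permCongrHom.injective]
  rfl

theorem IsCoords.isElementaryTwoAbelian (hE : IsCoords χ E) (hcop : d.Coprime e)
    (he : Squarefree e) (hχ : Function.Injective χ) : IsElementaryTwoAbelian (T G) := by
  have hsq : ∀ x : T G, x * x = 1 := by
    intro x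
    obtain ⟨⟨π, hπ⟩, rfl⟩ := QuotientGroup.mk_surjective x
    rw [← QuotientGroup.mk_mul, QuotientGroup.eq_one_iff, Subgroup.mem_subgroupOf]
    have h1 : E.permCongrHom.toMonoidHom π ∈ (NHol G).map E.permCongrHom.toMonoidHom :=
      Subgroup.mem_map_of_mem _ hπ
    rw [hE.map_nHol hcop hχ] at h1
    have h2 := mul_self_mem_affGroup hcop he hχ h1
    rw [← hE.map_hol hcop hχ, ← map_mul] at h2
    exact (Subgroup.mem_map_iff_mem E.permCongrHom.injective).mp h2
  refine ⟨fun x y => ?_, fun x => by rw [pow_two, hsq]⟩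
  have hinv : ∀ x : T G, x⁻¹ = x := fun x => inv_eq_of_mul_eq_one_right (hsq x)
  rw [← hinv (x * y), mul_inv_rev, hinv, hinv]

end Quotient

/-! ### Multiplicative orders modulo squarefree numbers -/

section Orders

variable {k : ℕ}

theorem ordMod_dvd_iff {f : ℕ} (hf : Squarefree f) (n : ℕ) :
    ordMod k f ∣ n ↔ ∀ q, q.Prime → q ∣ f → (k : ZMod q) ^ n = 1 := by
  have : NeZero f := ⟨hf.ne_zero⟩
  rw [ordMod, orderOf_dvd_iff_pow_eq_one]
  constructor
  · intro h q _ hqf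
    rw [← map_natCast (ZMod.castHom hqf (ZMod q)), ← map_pow, h, map_one]
  · intro h
    refine eq_of_forall_castHom_eq hf fun q hq hqf => ?_
    rw [map_pow, map_natCast, h q hq hqf, map_one]

theorem ordMod_dvd_ordMod {f f' : ℕ} (h : f ∣ f') : ordMod k f ∣ ordMod k f' := by
  rw [ordMod, orderOf_dvd_iff_pow_eq_one]
  rw [← map_natCast (ZMod.castHom h (ZMod f)), ← map_pow, ordMod, pow_orderOf_eq_one, map_one]

/-- Otherwise `k` raised to `ordMod k f / p` would already be `1` modulo every prime of `f`,
contradicting minimality. -/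
theorem exists_prime_dvd_ordMod {f p : ℕ} (hf : Squarefree f) (hp : p.Prime) (h0 : 0 < ordMod k f)
    (h : p ∣ ordMod k f) : ∃ q, q.Prime ∧ q ∣ f ∧ p ∣ ordMod k q := by
  by_contra! hcon
  obtain ⟨m, hm⟩ := h
  have hm0 : 0 < m := Nat.pos_of_ne_zero (by rintro rfl; omega)
  have hdvd : ordMod k f ∣ m := by
    rw [ordMod_dvd_iff hf]
    intro q hq hqf
    rw [← orderOf_dvd_iff_pow_eq_one]
    have h1 : ordMod k q ∣ p * m := hm ▸ ordMod_dvd_ordMod hqf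
    exact Nat.Coprime.dvd_of_dvd_mul_left ((hp.coprime_iff_not_dvd.mpr (hcon q hq hqf)).symm) h1
  have := Nat.le_of_dvd hm0 hdvd
  have := hp.two_le
  nlinarith

/-- The gcd divides the squarefree `d`, so it suffices that its only possible prime divisor is 2; a
prime dividing it already divides the orders at some `q ∣ f₁` and `q' ∣ f₂`. -/
theorem gcd_ordMod_le_two_iff {d f₁ f₂ : ℕ} (hd : Squarefree d) (h₁ : Squarefree f₁)
    (h₂ : Squarefree f₂) (hd₁ : ordMod k f₁ ∣ d) (hd₂ : ordMod k f₂ ∣ d) :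
    Nat.gcd (ordMod k f₁) (ordMod k f₂) ≤ 2 ↔
      ∀ q q', q.Prime → q'.Prime → q ∣ f₁ → q' ∣ f₂ →
        Nat.gcd (ordMod k q) (ordMod k q') ≤ 2 := by
  have pos₁ := Nat.pos_of_dvd_of_pos hd₁ (Nat.pos_of_ne_zero hd.ne_zero)
  have pos₂ := Nat.pos_of_dvd_of_pos hd₂ (Nat.pos_of_ne_zero hd.ne_zero)
  constructor
  · intro h q q' _ _ hq hq'
    exact (Nat.le_of_dvd (Nat.gcd_pos_of_pos_left _ pos₁)
      (gcd_dvd_gcd (ordMod_dvd_ordMod hq) (ordMod_dvd_ordMod hq'))).trans h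
  · intro h
    refine Nat.le_of_dvd two_pos ?_
    refine dvd_of_forall_prime_dvd (hd.squarefree_of_dvd ((Nat.gcd_dvd_left _ _).trans hd₁))
      fun p hp hpd => ?_
    obtain ⟨q, hq, hqf, hpq⟩ := exists_prime_dvd_ordMod h₁ hp pos₁ (hpd.trans (Nat.gcd_dvd_left _ _))
    obtain ⟨q', hq', hqf', hpq'⟩ :=
      exists_prime_dvd_ordMod h₂ hp pos₂ (hpd.trans (Nat.gcd_dvd_right _ _))
    have pos := Nat.pos_of_dvd_of_pos (ordMod_dvd_ordMod hqf) pos₁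
    have hle := (Nat.le_of_dvd (Nat.gcd_pos_of_pos_left _ pos) (Nat.dvd_gcd hpq hpq')).trans
      (h q q' hq hq' hqf hqf')
    rw [hle.antisymm hp.two_le]

theorem gcd_ordMod_le_two_iff_exists {d f₁ f₂ : ℕ} (hd : 0 < d) (h₁ : Squarefree f₁)
    (h₂ : Squarefree f₂) (hd₁ : ordMod k f₁ ∣ d) (hd₂ : ordMod k f₂ ∣ d) :
    Nat.gcd (ordMod k f₁) (ordMod k f₂) ≤ 2 ↔
      ∃ v : ℕ, (∀ q, q.Prime → q ∣ f₁ → (k : ZMod q) ^ v = k) ∧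
        ∀ q, q.Prime → q ∣ f₂ → (k : ZMod q) ^ (v + 1) = 1 := by
  have pos₁ := Nat.pos_of_dvd_of_pos hd₁ hd
  have pos₂ := Nat.pos_of_dvd_of_pos hd₂ hd
  have hpos : 0 < Nat.gcd (ordMod k f₁) (ordMod k f₂) := Nat.gcd_pos_of_pos_left _ pos₁
  have hone : ∀ q, q.Prime → q ∣ f₁ → (k : ZMod q) ^ ordMod k f₁ = 1 :=
    (ordMod_dvd_iff h₁ _).mp dvd_rfl
  constructor
  · intro h
    have h2 : Nat.gcd (ordMod k f₁) (ordMod k f₂) ∣ 2 := by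
      interval_cases Nat.gcd (ordMod k f₁) (ordMod k f₂) <;> decide
    -- In natural numbers, `ordMod k f₂ - 1` plays the role of `-1`; compatibility of the two
    -- congruences is divisibility of 2 by the gcd.
    have hmod : 1 ≡ ordMod k f₂ - 1 [MOD Nat.gcd (ordMod k f₁) (ordMod k f₂)] := by
      rw [Nat.modEq_iff_dvd]
      have e1 : ((ordMod k f₂ - 1 : ℕ) : ℤ) - (1 : ℕ) = ordMod k f₂ - (2 : ℕ) := by
        push_cast [Nat.cast_sub (show 1 ≤ ordMod k f₂ from pos₂)]; ring
      rw [e1]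
      exact dvd_sub (Int.natCast_dvd_natCast.mpr (Nat.gcd_dvd_right _ _))
        (Int.natCast_dvd_natCast.mpr h2)
    obtain ⟨v, hv₁, hv₂⟩ := Nat.chineseRemainder' hmod
    refine ⟨v, fun q hq hqf => ?_, ?_⟩
    · have h3 : v ≡ 1 [MOD orderOf (k : ZMod q)] := hv₁.of_dvd (ordMod_dvd_ordMod hqf)
      nth_rewrite 2 [← pow_one (k : ZMod q)]
      rw [← pow_mod_orderOf, h3, pow_mod_orderOf]
    · rw [← ordMod_dvd_iff h₂]
      have h3 : v + 1 ≡ ordMod k f₂ - 1 + 1 [MOD ordMod k f₂] := hv₂.add_right 1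
      rw [Nat.sub_add_cancel pos₂] at h3
      exact (h3.dvd_iff dvd_rfl).mpr dvd_rfl
  · rintro ⟨v, hv₁, hv₂⟩
    rw [← ordMod_dvd_iff h₂] at hv₂
    have h3 : ordMod k f₁ ∣ v + (ordMod k f₁ - 1) := by
      rw [ordMod_dvd_iff h₁]
      intro q hq hqf
      rw [pow_add, hv₁ q hq hqf, ← pow_succ', Nat.sub_add_cancel pos₁, hone q hq hqf]
    have h4 : Nat.gcd (ordMod k f₁) (ordMod k f₂) ∣ v + (ordMod k f₁ - 1) :=
      (Nat.gcd_dvd_left _ _).trans h3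
    have h5 : Nat.gcd (ordMod k f₁) (ordMod k f₂) ∣ (v + 1) + ordMod k f₁ :=
      dvd_add ((Nat.gcd_dvd_right _ _).trans hv₂) (Nat.gcd_dvd_left _ _)
    have h6 := Nat.dvd_sub h5 h4
    have h7 : v + 1 + ordMod k f₁ - (v + (ordMod k f₁ - 1)) = 2 := by omega
    rw [h7] at h6
    exact Nat.le_of_dvd two_pos h6

end Orders

/-! ### Twists, closed sets of primes and factorizations of `g` -/

section Subsets

variable {d e k : ℕ}

theorem gOf_dvd : gOf e k ∣ e := Nat.div_dvd_of_dvd (Nat.gcd_dvd_left _ _)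

/-- As `e` is squarefree, `z` and `g` are coprime and share out its primes; those of `z` are the
ones dividing `k - 1`. -/
theorem prime_dvd_gOf_iff (hk : 0 < k) (he : Squarefree e) {q : ℕ} (hq : q.Prime) (hqe : q ∣ e) :
    q ∣ gOf e k ↔ (k : ZMod q) ≠ 1 := by
  have hzg : zOf e k * gOf e k = e := Nat.mul_div_cancel' (Nat.gcd_dvd_left _ _)
  have hcop : Nat.Coprime (zOf e k) (gOf e k) := Nat.coprime_of_squarefree_mul (hzg.symm ▸ he)
  have h1 : (k : ZMod q) = 1 ↔ q ∣ k - 1 := by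
    rw [← Nat.modEq_iff_dvd' hk, ← Nat.cast_one, ZMod.natCast_eq_natCast_iff, Nat.ModEq.comm]
  rw [ne_eq, h1]
  constructor
  · intro h h2
    exact hq.one_lt.ne' (Nat.eq_one_of_dvd_coprimes hcop (Nat.dvd_gcd hqe h2) h)
  · intro h
    have h2 : q ∣ zOf e k * gOf e k := hzg.symm ▸ hqe
    exact (hq.dvd_mul.mp h2).resolve_left fun h3 => h (h3.trans (Nat.gcd_dvd_right _ _))

/-- No edge of the graph on the prime factors of `g` leaves `S`. -/
def IsClosedSet (g k : ℕ) (S : Set {q : ℕ // q ∈ g.primeFactors}) : Prop :=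
  ∀ a b, a ∉ S → b ∈ S → ¬ (primeGraph g k).Adj a b

/-- Membership in a closed set is constant along walks, so closed sets are the preimages of
arbitrary sets of components. -/
theorem card_isClosedSet (g k : ℕ) :
    Nat.card {S // IsClosedSet g k S} =
      2 ^ Nat.card (primeGraph g k).ConnectedComponent := by
  have hclosed : ∀ S, IsClosedSet g k S → ∀ a b, (primeGraph g k).Reachable a b →
      (a ∈ S ↔ b ∈ S) := by
    rintro S hS a b ⟨w⟩
    induction w with
    | nil => rfl
    | cons h _ ih =>
      rw [← ih]
      exact ⟨fun h1 => by_contra fun h2 => hS _ _ h2 h1 h.symm,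
        fun h1 => by_contra fun h2 => hS _ _ h2 h1 h⟩
  let Φ : Set (primeGraph g k).ConnectedComponent → {S // IsClosedSet g k S} := fun C =>
    ⟨(primeGraph g k).connectedComponentMk ⁻¹' C, fun a b ha hb hab => ha (by
      rw [Set.mem_preimage, SimpleGraph.ConnectedComponent.sound hab.reachable]
      exact hb)⟩
  have hΦ : Function.Bijective Φ := by
    constructor
    · intro C C' h
      exact (Set.preimage_injective.mpr Quot.mk_surjective) (congrArg Subtype.val h)
    · rintro ⟨S, hS⟩
      refine ⟨(primeGraph g k).connectedComponentMk '' S, Subtype.ext ?_⟩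
      ext b
      constructor
      · rintro ⟨a, ha, hab⟩
        exact (hclosed S hS a b (SimpleGraph.ConnectedComponent.exact hab)).mp ha
      · exact fun hb => ⟨b, hb, rfl⟩
  have : Finite (primeGraph g k).ConnectedComponent := Quot.finite _
  have := Fintype.ofFinite (primeGraph g k).ConnectedComponent
  rw [← Nat.card_eq_of_bijective Φ hΦ, Nat.card_eq_fintype_card, Fintype.card_set,
    Nat.card_eq_fintype_card]

open Classical in
theorem exists_factorization {g : ℕ} (hg : Squarefree g) (S : Set {q : ℕ // q ∈ g.primeFactors}) :
    ∃ f₁ f₂ : ℕ, g = f₁ * f₂ ∧ (∀ q : {q : ℕ // q ∈ g.primeFactors}, q.1 ∣ f₂ ↔ q ∈ S) ∧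
      ∀ q : {q : ℕ // q ∈ g.primeFactors}, q.1 ∣ f₁ ↔ q ∉ S := by
  have hdvd : ∀ (P : {q : ℕ // q ∈ g.primeFactors} → Prop) [DecidablePred P]
      (q : {q : ℕ // q ∈ g.primeFactors}),
      q.1 ∣ ∏ p with P p, p.1 ↔ P q := by
    intro P _ q
    rw [(Nat.prime_of_mem_primeFactors q.2).prime.dvd_finsetProd_iff]
    constructor
    · rintro ⟨p, hp, hqp⟩
      rw [Nat.prime_dvd_prime_iff_eq (Nat.prime_of_mem_primeFactors q.2)
        (Nat.prime_of_mem_primeFactors p.2)] at hqp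
      rw [Subtype.ext hqp]
      exact (Finset.mem_filter.mp hp).2
    · exact fun hq => ⟨q, Finset.mem_filter.mpr ⟨Finset.mem_univ _, hq⟩, dvd_rfl⟩
  refine ⟨∏ p with p ∉ S, p.1, ∏ p with p ∈ S, p.1, ?_, hdvd (· ∈ S), hdvd (· ∉ S)⟩
  rw [mul_comm, Finset.prod_filter_mul_prod_filter_not]
  exact (Nat.prod_primeFactors_of_squarefree hg).symm.trans
    (Finset.prod_coe_sort g.primeFactors id).symm

theorem isClosedSet_iff_gcd {g f₁ f₂ : ℕ} (hd : Squarefree d) (hg : Squarefree g)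
    (hgd : ordMod k g ∣ d) (h : g = f₁ * f₂) {S : Set {q : ℕ // q ∈ g.primeFactors}}
    (hS₂ : ∀ q : {q : ℕ // q ∈ g.primeFactors}, q.1 ∣ f₂ ↔ q ∈ S)
    (hS₁ : ∀ q : {q : ℕ // q ∈ g.primeFactors}, q.1 ∣ f₁ ↔ q ∉ S) :
    IsClosedSet g k S ↔ Nat.gcd (ordMod k f₁) (ordMod k f₂) ≤ 2 := by
  have hf₁ : f₁ ∣ g := h ▸ dvd_mul_right _ _
  have hf₂ : f₂ ∣ g := h ▸ dvd_mul_left _ _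
  rw [gcd_ordMod_le_two_iff hd (hg.squarefree_of_dvd hf₁) (hg.squarefree_of_dvd hf₂)
    ((ordMod_dvd_ordMod hf₁).trans hgd) ((ordMod_dvd_ordMod hf₂).trans hgd)]
  constructor
  · intro hS q q' hq hq' hqf hqf'
    have m := Nat.mem_primeFactors.mpr ⟨hq, hqf.trans hf₁, hg.ne_zero⟩
    have m' := Nat.mem_primeFactors.mpr ⟨hq', hqf'.trans hf₂, hg.ne_zero⟩
    have n := (hS₁ ⟨q, m⟩).mp hqf
    have n' := (hS₂ ⟨q', m'⟩).mp hqf'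
    by_contra hlt
    exact hS _ _ n n' ⟨fun heq => n (heq ▸ n'), not_le.mp hlt⟩
  · intro hq a b ha hb hab
    have h1 := hq a b (Nat.prime_of_mem_primeFactors a.2) (Nat.prime_of_mem_primeFactors b.2)
      ((hS₁ a).mpr ha) ((hS₂ b).mpr hb)
    have h2 := hab.2
    omega

/-- A set of primes is closed if and only if some power map inverts `k` modulo its members and
fixes `k` modulo the others. -/
theorem isClosedSet_iff_exists {g : ℕ} (hd : Squarefree d) (hg : Squarefree g)
    (hgd : ordMod k g ∣ d) (S : Set {q : ℕ // q ∈ g.primeFactors}) :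
    IsClosedSet g k S ↔ ∃ v : ℕ, (∀ q, q ∉ S → (k : ZMod q.1) ^ v = k) ∧
      ∀ q ∈ S, (k : ZMod q.1) ^ (v + 1) = 1 := by
  obtain ⟨f₁, f₂, h, hS₂, hS₁⟩ := exists_factorization hg S
  have hf₁ : f₁ ∣ g := h ▸ dvd_mul_right _ _
  have hf₂ : f₂ ∣ g := h ▸ dvd_mul_left _ _
  rw [isClosedSet_iff_gcd hd hg hgd h hS₂ hS₁,
    gcd_ordMod_le_two_iff_exists (Nat.pos_of_ne_zero hd.ne_zero) (hg.squarefree_of_dvd hf₁)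
      (hg.squarefree_of_dvd hf₂) ((ordMod_dvd_ordMod hf₁).trans hgd)
      ((ordMod_dvd_ordMod hf₂).trans hgd)]
  refine exists_congr fun v => and_congr ⟨fun h1 q hq => ?_, fun h1 q hq hqf => ?_⟩
    ⟨fun h1 q hq => ?_, fun h1 q hq hqf => ?_⟩
  · exact h1 q (Nat.prime_of_mem_primeFactors q.2) ((hS₁ q).mpr hq)
  · have m := Nat.mem_primeFactors.mpr ⟨hq, hqf.trans hf₁, hg.ne_zero⟩
    exact h1 ⟨q, m⟩ ((hS₁ ⟨q, m⟩).mp hqf)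
  · exact h1 q (Nat.prime_of_mem_primeFactors q.2) ((hS₂ q).mpr hq)
  · have m := Nat.mem_primeFactors.mpr ⟨hq, hqf.trans hf₂, hg.ne_zero⟩
    exact h1 ⟨q, m⟩ ((hS₂ ⟨q, m⟩).mp hqf)

/-- A factorization of the squarefree `g` is determined by the primes of `f₂`, and the gcd condition
says that this set is closed. -/
theorem ncard_oSet {g : ℕ} (hd : Squarefree d) (hg : Squarefree g) (hgd : ordMod k g ∣ d) :
    (oSet g k).ncard = Nat.card {S // IsClosedSet g k S} := by
  have hcompl : ∀ {f₁ f₂ : ℕ}, g = f₁ * f₂ → ∀ q : {q : ℕ // q ∈ g.primeFactors},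
      q.1 ∣ f₁ ↔ ¬ q.1 ∣ f₂ := by
    intro f₁ f₂ h q
    have hq := Nat.prime_of_mem_primeFactors q.2
    have hcop : Nat.Coprime f₁ f₂ := Nat.coprime_of_squarefree_mul (h ▸ hg)
    constructor
    · exact fun h1 h2 => hq.one_lt.ne' (Nat.eq_one_of_dvd_coprimes hcop h1 h2)
    · exact (hq.dvd_mul.mp (h ▸ Nat.dvd_of_mem_primeFactors q.2)).resolve_right
  rw [← Nat.card_coe_set_eq]
  let Φ : oSet g k → {S // IsClosedSet g k S} := fun p =>
    ⟨{q | q.1 ∣ p.1.2}, (isClosedSet_iff_gcd hd hg hgd p.2.2.2.1 (fun _ => Iff.rfl)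
      (hcompl p.2.2.2.1)).mpr p.2.2.2.2⟩
  refine Nat.card_eq_of_bijective Φ ⟨?_, ?_⟩
  · have hdvd : ∀ p p' : oSet g k, Φ p = Φ p' → p.1.2 ∣ p'.1.2 := by
      rintro ⟨⟨f₁, f₂⟩, _, _, h, _⟩ ⟨⟨f₁', f₂'⟩, _, _, h', _⟩ heq
      have hf₂ : f₂ ∣ g := ⟨f₁, h.trans (mul_comm _ _)⟩
      refine dvd_of_forall_prime_dvd (hg.squarefree_of_dvd hf₂) fun q hq hqf => ?_
      have m := Nat.mem_primeFactors.mpr ⟨hq, hqf.trans hf₂, hg.ne_zero⟩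
      exact (Set.ext_iff.mp (congrArg Subtype.val heq) ⟨q, m⟩).mp hqf
    intro p p' heq
    have h2 : p.1.2 = p'.1.2 := Nat.dvd_antisymm (hdvd p p' heq) (hdvd p' p heq.symm)
    refine Subtype.ext (Prod.ext ?_ h2)
    apply Nat.eq_of_mul_eq_mul_right p.2.2.1
    rw [← p.2.2.2.1, h2, ← p'.2.2.2.1]
  · rintro ⟨S, hS⟩
    obtain ⟨f₁, f₂, h, hS₂, hS₁⟩ := exists_factorization hg S
    have hpos : 0 < f₁ * f₂ := h ▸ Nat.pos_of_ne_zero hg.ne_zero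
    refine ⟨⟨(f₁, f₂), Nat.pos_of_mul_pos_right hpos, Nat.pos_of_mul_pos_left hpos, h,
      (isClosedSet_iff_gcd hd hg hgd h hS₂ hS₁).mp hS⟩, Subtype.ext ?_⟩
    ext q
    exact hS₂ q

variable {χ : AddChar (ZMod d) (ZMod e)}

/-- The two alternatives coincide where `k` is `1` modulo `q`; assigning that case to the first one
makes them exclusive. -/
theorem IsTwist.dichotomy {ψ : AddChar (ZMod d) (ZMod e)} {v : ZMod d} (h : IsTwist χ ψ v)
    (hχ1 : χ 1 = k) {q : ℕ} (hq : q.Prime) (hqe : q ∣ e) :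
    (ZMod.castHom hqe (ZMod q) (ψ 1) = 1 ∧ ZMod.castHom hqe (ZMod q) (χ v) = k) ∨
    ((k : ZMod q) ≠ 1 ∧ ZMod.castHom hqe (ZMod q) (ψ 1) * k = 1 ∧
      ZMod.castHom hqe (ZMod q) (χ v) * k = 1) := by
  rcases h q hq hqe with h1 | h1
  · have h2 := h1 1
    rw [mul_one, hχ1, map_natCast] at h2
    exact Or.inl h2
  · have h2 := h1 1
    rw [mul_one, hχ1, map_natCast] at h2
    by_cases hk : (k : ZMod q) = 1
    · rw [hk, mul_one, mul_one] at h2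
      rw [hk]
      exact Or.inl h2
    · exact Or.inr ⟨hk, h2⟩

/-- Send a twist to the set of primes of `g` at which `ψ(1) ≠ 1`. The set determines `ψ(1)` and
`χ(v)` modulo every prime of `e`, hence `ψ` and, by injectivity of `χ`, also `v`. -/
theorem card_isTwist [NeZero d] (hk : 0 < k) (hd : Squarefree d) (he : Squarefree e)
    (hgd : ordMod k (gOf e k) ∣ d) (hχ : Function.Injective χ) (hχ1 : χ 1 = k) :
    Nat.card {p : AddChar (ZMod d) (ZMod e) × ZMod d // IsTwist χ p.1 p.2} =
      Nat.card {S // IsClosedSet (gOf e k) k S} := by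
  classical
  have : NeZero e := ⟨he.ne_zero⟩
  have hg : Squarefree (gOf e k) := he.squarefree_of_dvd gOf_dvd
  have hVe : ∀ q : {q : ℕ // q ∈ (gOf e k).primeFactors}, q.1 ∣ e :=
    fun q => (Nat.dvd_of_mem_primeFactors q.2).trans gOf_dvd
  have hVp : ∀ q : {q : ℕ // q ∈ (gOf e k).primeFactors}, q.1.Prime :=
    fun q => Nat.prime_of_mem_primeFactors q.2
  have hV1 : ∀ q : {q : ℕ // q ∈ (gOf e k).primeFactors}, (k : ZMod q.1) ≠ 1 := fun q =>
    (prime_dvd_gOf_iff hk he (hVp q) (hVe q)).mp (Nat.dvd_of_mem_primeFactors q.2)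
  have hpow : ∀ {q : ℕ} (hqe : q ∣ e) (n : ℕ),
      ZMod.castHom hqe (ZMod q) (χ n) = (k : ZMod q) ^ n := by
    intro q hqe n
    rw [← nsmul_one, AddChar.map_nsmul_eq_pow, hχ1, map_pow, map_natCast]
  have hunit : ∀ {q : ℕ} (hqe : q ∣ e), ZMod.castHom hqe (ZMod q) (χ (-1)) * k = 1 := by
    intro q hqe
    have h := congrArg (ZMod.castHom hqe (ZMod q)) (addChar_neg_mul χ 1)
    rwa [map_mul, hχ1, map_natCast, map_one (ZMod.castHom hqe (ZMod q))] at h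
  let Φ : {p : AddChar (ZMod d) (ZMod e) × ZMod d // IsTwist χ p.1 p.2} →
      {S // IsClosedSet (gOf e k) k S} := fun p =>
    ⟨{q | ZMod.castHom (hVe q) (ZMod q.1) (p.1.1 1) ≠ 1},
      (isClosedSet_iff_exists hd hg hgd _).mpr ⟨p.1.2.val, fun q hq => by
        rw [← hpow (hVe q), ZMod.natCast_zmod_val]
        rcases p.2.dichotomy hχ1 (hVp q) (hVe q) with h | h
        · exact h.2
        · rw [Set.mem_ofPred_eq, not_not] at hq
          rw [hq, one_mul] at h
          exact absurd h.2.1 h.1, fun q hq => by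
        rw [pow_succ, ← hpow (hVe q), ZMod.natCast_zmod_val]
        rcases p.2.dichotomy hχ1 (hVp q) (hVe q) with h | h
        · exact absurd h.1 hq
        · exact h.2.2⟩⟩
  refine Nat.card_eq_of_bijective Φ ⟨?_, ?_⟩
  · rintro ⟨⟨ψ, v⟩, h⟩ ⟨⟨ψ', v'⟩, h'⟩ heq
    have hiff : ∀ q : {q : ℕ // q ∈ (gOf e k).primeFactors},
        ZMod.castHom (hVe q) (ZMod q.1) (ψ 1) ≠ 1 ↔
        ZMod.castHom (hVe q) (ZMod q.1) (ψ' 1) ≠ 1 := by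
      intro q
      have := congrArg Subtype.val heq
      exact Set.ext_iff.mp this q
    have key : ∀ q, q.Prime → ∀ hq : q ∣ e,
        ZMod.castHom hq (ZMod q) (ψ 1) = ZMod.castHom hq (ZMod q) (ψ' 1) ∧
        ZMod.castHom hq (ZMod q) (χ v) = ZMod.castHom hq (ZMod q) (χ v') := by
      intro q hq hqe
      have := Fact.mk hq
      have hmem : (k : ZMod q) ≠ 1 → q ∈ (gOf e k).primeFactors := fun h1 =>
        Nat.mem_primeFactors.mpr ⟨hq, (prime_dvd_gOf_iff hk he hq hqe).mpr h1, hg.ne_zero⟩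
      rcases h.dichotomy hχ1 hq hqe with ⟨h1, h2⟩ | ⟨h1, h2, h3⟩ <;>
        rcases h'.dichotomy hχ1 hq hqe with ⟨h1', h2'⟩ | ⟨h1', h2', h3'⟩
      · rw [h1, h1', h2, h2']
        exact ⟨rfl, rfl⟩
      · have h4 := not_not.mp (mt (hiff ⟨q, hmem h1'⟩).mpr (not_not.mpr h1))
        rw [h4, one_mul] at h2'
        exact absurd h2' h1'
      · have h4 := not_not.mp (mt (hiff ⟨q, hmem h1⟩).mp (not_not.mpr h1'))
        rw [h4, one_mul] at h2
        exact absurd h2 h1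
      · have hk0 := right_ne_zero_of_mul_eq_one h2
        exact ⟨mul_right_cancel₀ hk0 (h2.trans h2'.symm), mul_right_cancel₀ hk0 (h3.trans h3'.symm)⟩
    have hψ : ψ = ψ' := by
      ext t
      rw [addChar_eq_pow ψ, addChar_eq_pow ψ',
        eq_of_forall_castHom_eq he fun q hq hqe => (key q hq hqe).1]
    have hv : v = v' := hχ (eq_of_forall_castHom_eq he fun q hq hqe => (key q hq hqe).2)
    subst hψ hv
    rfl
  · rintro ⟨S, hS⟩
    obtain ⟨v, hv₁, hv₂⟩ := (isClosedSet_iff_exists hd hg hgd S).mp hS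
    obtain ⟨ε, hε⟩ := exists_indicator he
      (fun q => ∃ h : q ∈ (gOf e k).primeFactors, (⟨q, h⟩ : {q // q ∈ (gOf e k).primeFactors}) ∈ S)
    have hidem : ε * ε = ε := by
      refine eq_of_forall_castHom_eq he fun q hq hqe => ?_
      rw [map_mul, hε q hq hqe]
      split_ifs <;> simp
    -- Glue `χ⁻¹` on the primes of `S` to the trivial character elsewhere; idempotency of `ε` makes
    -- the result multiplicative.
    let ψ : AddChar (ZMod d) (ZMod e) :=
      { toFun := fun t => (1 - ε) + ε * χ (-t)
        map_zero_eq_one' := by simp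
        map_add_eq_mul' := fun s t => by
          rw [neg_add, AddChar.map_add_eq_mul]
          linear_combination (χ (-s) + χ (-t) - χ (-s) * χ (-t) - 1) * hidem }
    have hψ1 : ψ 1 = (1 - ε) + ε * χ (-1) := rfl
    have hin : ∀ q ∈ S, ZMod.castHom (hVe q) (ZMod q.1) (ψ 1) =
        ZMod.castHom (hVe q) (ZMod q.1) (χ (-1)) := by
      intro q hq
      rw [hψ1, map_add, map_sub, map_mul, map_one, hε q (hVp q) (hVe q), if_pos ⟨q.2, hq⟩]
      ring
    have hout : ∀ {q : ℕ}, q.Prime → ∀ hqe : q ∣ e, (∀ h : q ∈ (gOf e k).primeFactors,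
        (⟨q, h⟩ : {q // q ∈ (gOf e k).primeFactors}) ∉ S) →
        ZMod.castHom hqe (ZMod q) (ψ 1) = 1 := by
      intro q hq hqe hqS
      rw [hψ1, map_add, map_sub, map_mul, map_one, hε q hq hqe,
        if_neg (by rintro ⟨h1, h2⟩; exact hqS h1 h2)]
      ring
    have htw : IsTwist χ ψ (v : ZMod d) := by
      refine isTwist_of_one fun q hq hqe => ?_
      rw [hpow, hχ1, map_natCast (ZMod.castHom hqe (ZMod q))]
      by_cases hqg : q ∈ (gOf e k).primeFactors
      · by_cases hqS : (⟨q, hqg⟩ : {q // q ∈ (gOf e k).primeFactors}) ∈ S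
        · right
          rw [hin _ hqS, hunit, ← pow_succ, hv₂ _ hqS]
          exact ⟨rfl, rfl⟩
        · exact Or.inl ⟨hout hq hqe fun _ => hqS, hv₁ _ hqS⟩
      · left
        have h1 : (k : ZMod q) = 1 := by
          by_contra h1
          exact hqg (Nat.mem_primeFactors.mpr
            ⟨hq, (prime_dvd_gOf_iff hk he hq hqe).mpr h1, hg.ne_zero⟩)
        rw [h1, one_pow]
        exact ⟨hout hq hqe fun h => absurd h hqg, rfl⟩
    refine ⟨⟨(ψ, (v : ZMod d)), htw⟩, Subtype.ext ?_⟩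
    ext q
    change ZMod.castHom (hVe q) (ZMod q.1) (ψ 1) ≠ 1 ↔ q ∈ S
    by_cases hq : q ∈ S
    · refine iff_of_true (fun h => hV1 q ?_) hq
      have := hunit (hVe q)
      rwa [← hin q hq, h, one_mul] at this
    · exact iff_of_false (not_not.mpr (hout (hVp q) (hVe q) fun _ => hq)) hq

end Subsets

/-! ### Existence of a presentation -/

section Existence

variable {G : Type*} [Group G] [Finite G]

/-- In a group of squarefree order, the centralizer of the commutator subgroup is cyclic. -/
theorem isCyclic_centralizer_commutator [IsZGroup G] :
    IsCyclic (Subgroup.centralizer (commutator G : Set G)) := by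
  let F := Subgroup.centralizer (commutator G : Set G)
  let f : F →* Abelianization G := Abelianization.of.comp F.subtype
  -- The kernel lies in the commutator subgroup, which `F` centralizes. As the abelianization is
  -- cyclic, `F` is a central extension of a cyclic group, hence abelian.
  have hf : f.ker ≤ Subgroup.center F := by
    intro x hx
    have hx' : (x : G) ∈ commutator G := by
      rw [← Abelianization.ker_of]
      exact hx
    rw [Subgroup.mem_center_iff]
    intro y
    exact Subtype.ext (Subgroup.mem_centralizer_iff.mp y.2 x hx').symm
  let _ : CommGroup F :=
    { (inferInstance : Group F) with
      mul_comm := (f.isMulCommutative_of_isCyclic_of_ker_le_center hf).is_comm.comm }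
  exact IsCyclic.of_exponent_eq_card (IsZGroup.exponent_eq_card F)

theorem commutator_le_centralizer_commutator [IsZGroup G] :
    commutator G ≤ Subgroup.centralizer (commutator G : Set G) := by
  have : IsCyclic (commutator G) := IsZGroup.isCyclic_commutator G
  intro x hx
  rw [Subgroup.mem_centralizer_iff]
  intro y hy
  exact congrArg Subtype.val (IsCyclic.isMulCommutative.is_comm.comm (⟨y, hy⟩ : commutator G) ⟨x, hx⟩)

theorem exists_presentation (hG : Squarefree (Nat.card G)) :
    ∃ d e k : ℕ, IsParams d e k ∧ Nonempty (G ≃* GroupOf d e k) := by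
  have : IsZGroup G := IsZGroup.of_squarefree hG
  set F := Subgroup.centralizer (commutator G : Set G) with hF
  have hcomm : commutator G ≤ F := commutator_le_centralizer_commutator
  have hFcyc : IsCyclic F := isCyclic_centralizer_commutator
  have hQcyc : IsCyclic (G ⧸ F) := by
    have : IsCyclic (G ⧸ commutator G) := IsZGroup.isCyclic_abelianization
    exact isCyclic_of_surjective (QuotientGroup.map (commutator G) F (MonoidHom.id G) hcomm)
      (QuotientGroup.map_surjective_of_surjective _ _ _
        (QuotientGroup.mk_surjective.comp Function.surjective_id) hcomm)
  set d := Nat.card (G ⧸ F) with hd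
  set e := Nat.card F with he
  have hcard : Nat.card G = d * e := F.card_eq_card_quotient_mul_card_subgroup
  have hcop : Nat.Coprime d e := Nat.coprime_of_squarefree_mul (hcard ▸ hG)
  have hdpos : 0 < d := Nat.card_pos
  have hepos : 0 < e := Nat.card_pos
  obtain ⟨⟨σ, hσF⟩, hσ⟩ := IsCyclic.exists_generator (α := F)
  have hσgen : ∀ x ∈ F, x ∈ Subgroup.zpowers σ := by
    intro x hx
    obtain ⟨n, hn⟩ := hσ ⟨x, hx⟩
    exact ⟨n, congrArg Subtype.val hn⟩
  have hσord : orderOf σ = e := by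
    rw [he, ← orderOf_eq_card_of_forall_mem_zpowers hσ, Subgroup.orderOf_mk]
  have hσe : σ ^ e = 1 := by rw [← hσord, pow_orderOf_eq_one]
  have hcent : ∀ x : G, x * σ = σ * x → x ∈ F := by
    intro x hx
    rw [hF, Subgroup.mem_centralizer_iff]
    intro y hy
    obtain ⟨n, rfl⟩ := hσgen y (hcomm hy)
    exact (Commute.zpow_left (show Commute σ x from hx.symm) n).eq
  obtain ⟨q₀, hq₀⟩ := IsCyclic.exists_generator (α := G ⧸ F)
  obtain ⟨τ₀, rfl⟩ := QuotientGroup.mk_surjective q₀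
  -- Raising to the power `e` forces `τ ^ d = 1`, and the image still generates `G ⧸ F` because `d`
  -- and `e` are coprime.
  set τ := τ₀ ^ e with hτ
  have hτd : τ ^ d = 1 := by
    rw [hτ, ← pow_mul, mul_comm, ← hcard, pow_card_eq_one']
  have hτord : orderOf (τ : G ⧸ F) = d := by
    have h1 : orderOf (τ₀ : G ⧸ F) = d := orderOf_eq_card_of_forall_mem_zpowers hq₀
    rw [hτ, QuotientGroup.mk_pow, Nat.Coprime.orderOf_pow (h1.symm ▸ hcop), h1]
  have hτgen : ∀ x : G ⧸ F, x ∈ Subgroup.zpowers (τ : G ⧸ F) := by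
    have h1 : Subgroup.zpowers (τ : G ⧸ F) = ⊤ :=
      Subgroup.eq_top_of_card_eq _ (by rw [Nat.card_zpowers, hτord])
    intro x
    rw [h1]
    exact Subgroup.mem_top x
  obtain ⟨k₀, hk₀⟩ : τ * σ * τ⁻¹ ∈ Submonoid.powers σ := by
    rw [mem_powers_iff_mem_zpowers]
    have hn : F.Normal := inferInstance
    exact hσgen _ (hn.conj_mem σ hσF τ)
  -- Adding `e` ensures that `k` is positive without changing `σ ^ k`.
  set k := k₀ + e with hk
  have hrel : τ * σ * τ⁻¹ = σ ^ k := by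
    rw [hk, pow_add, hσe, mul_one]
    exact hk₀.symm
  -- `k ^ n = 1` means that `τ ^ n` commutes with `σ`. As `σ` generates `F`, which is abelian and
  -- contains the commutator subgroup, this is equivalent to `τ ^ n ∈ F`.
  have hpow : ∀ n : ℕ, (k : ZMod e) ^ n = 1 ↔ d ∣ n := by
    intro n
    have h1 := pow_mul_pow_of_conj hrel n 1
    rw [mul_one, pow_one] at h1
    have h2 : (k : ZMod e) ^ n = 1 ↔ σ ^ k ^ n = σ := by
      have h5 := pow_inj_mod (x := σ) (m := k ^ n) (n := 1)
      rw [pow_one, hσord, ← ZMod.natCast_eq_natCast_iff', Nat.cast_pow, Nat.cast_one] at h5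
      exact eq_comm.trans (h5.symm.trans eq_comm)
    have h3 : σ ^ k ^ n = σ ↔ τ ^ n ∈ F := by
      constructor
      · intro h
        exact hcent _ (by rw [h1, h])
      · intro h
        obtain ⟨m, hm⟩ := hσgen _ h
        have h4 : τ ^ n * σ = σ * τ ^ n := by
          rw [← hm]
          exact (Commute.zpow_left (Commute.refl σ) m).eq
        exact mul_right_cancel (h1.symm.trans h4)
    rw [h2, h3, ← hτord, orderOf_dvd_iff_pow_eq_one, ← QuotientGroup.mk_pow,
      QuotientGroup.eq_one_iff]
  have hparams : IsParams d e k :=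
    { d_pos := hdpos
      e_pos := hepos
      k_pos := by omega
      coprime := (ZMod.isUnit_iff_coprime k e).mp
        (IsUnit.of_pow_eq_one ((hpow d).mpr dvd_rfl) hdpos.ne')
      ord_eq := by
        refine Nat.dvd_antisymm ?_ ?_
        · exact orderOf_dvd_of_pow_eq_one ((hpow d).mpr dvd_rfl)
        · exact (hpow _).mp (pow_orderOf_eq_one _) }
  refine ⟨d, e, k, hparams, ?_⟩
  have hlift : ∀ r ∈ relators d e k, FreeGroup.lift ![σ, τ] r = 1 := by
    intro r hr
    rcases hr with rfl | rfl | rfl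
    · simpa using hσe
    · simpa using hτd
    · simp [hrel]
  let Φ : GroupOf d e k →* G := PresentedGroup.toGroup hlift
  have hΦσ : Φ (PresentedGroup.of 0) = σ := PresentedGroup.toGroup.of hlift
  have hΦτ : Φ (PresentedGroup.of 1) = τ := PresentedGroup.toGroup.of hlift
  have hsurj : Function.Surjective Φ := by
    intro x
    obtain ⟨n, hn⟩ := hτgen (x : G ⧸ F)
    have h1 : (τ ^ n)⁻¹ * x ∈ F := by
      rw [← QuotientGroup.eq, QuotientGroup.mk_zpow]
      exact hn
    obtain ⟨m, hm⟩ := hσgen _ h1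
    refine ⟨PresentedGroup.of 1 ^ n * PresentedGroup.of 0 ^ m, ?_⟩
    rw [map_mul, map_zpow, map_zpow, hΦσ, hΦτ]
    have h2 : σ ^ m = (τ ^ n)⁻¹ * x := hm
    rw [h2, mul_inv_cancel_left]
  -- The coordinates are needed here only for the order `d e` of the presented group, which makes
  -- the surjection bijective.
  obtain ⟨χ, -, -, E, -⟩ := exists_coords hparams
  have hcard' : Nat.card (GroupOf d e k) = Nat.card G := by
    rw [Nat.card_congr E, Nat.card_prod, Nat.card_zmod, Nat.card_zmod, hcard, mul_comm]
  have : Finite (GroupOf d e k) := Nat.finite_of_card_ne_zero (hcard' ▸ hG.ne_zero)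
  have hbij : Function.Bijective Φ := hsurj.bijective_of_nat_card_le hcard'.le
  exact ⟨(MulEquiv.ofBijective Φ hbij).symm⟩

end Existence

/-! ### Assembling the theorem -/

/-- The coordinates of a group of squarefree order given by a presentation. -/
theorem exists_coords_of_mulEquiv {G : Type*} [Group G] (hG : Squarefree (Nat.card G))
    {d e k : ℕ} (h : IsParams d e k) (φ : G ≃* GroupOf d e k) :
    d.Coprime e ∧ Squarefree d ∧ Squarefree e ∧
      ∃ χ : AddChar (ZMod d) (ZMod e), χ 1 = k ∧ Function.Injective χ ∧
        ∃ E : G ≃ ZMod e × ZMod d, IsCoords χ E := by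
  obtain ⟨χ, hχ1, hχ, E, hE⟩ := exists_coords h
  have hcard : Nat.card G = d * e := by
    rw [Nat.card_congr (φ.toEquiv.trans E), Nat.card_prod, Nat.card_zmod, Nat.card_zmod, mul_comm]
  rw [hcard] at hG
  refine ⟨Nat.coprime_of_squarefree_mul hG, hG.squarefree_of_dvd (dvd_mul_right _ _),
    hG.squarefree_of_dvd (dvd_mul_left _ _), χ, hχ1, hχ, φ.toEquiv.trans E, fun x y => ?_⟩
  simpa using hE (φ x) (φ y)

end MultipleHolomorph

theorem theorem2p1 (G : Type*) [Group G] [Finite G] (hG : Squarefree (Nat.card G)) :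
    (∃ d e k : ℕ, MultipleHolomorph.IsParams d e k ∧
      Nonempty (G ≃* MultipleHolomorph.GroupOf d e k)) ∧
    MultipleHolomorph.IsElementaryTwoAbelian (MultipleHolomorph.T G) ∧
    ∀ d e k : ℕ, MultipleHolomorph.IsParams d e k →
      Nonempty (G ≃* MultipleHolomorph.GroupOf d e k) →
        Nat.card (MultipleHolomorph.T G) =
            (MultipleHolomorph.oSet (MultipleHolomorph.gOf e k) k).ncard ∧
          (MultipleHolomorph.oSet (MultipleHolomorph.gOf e k) k).ncard =
            2 ^ Nat.card (MultipleHolomorph.primeGraph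
              (MultipleHolomorph.gOf e k) k).ConnectedComponent := by
  open MultipleHolomorph in
  refine ⟨exists_presentation hG, ?_, ?_⟩
  · obtain ⟨d, e, k, h, ⟨φ⟩⟩ := exists_presentation hG
    have : NeZero d := ⟨h.d_pos.ne'⟩
    have : NeZero e := ⟨h.e_pos.ne'⟩
    obtain ⟨hcop, -, he, χ, -, hχ, E, hE⟩ := exists_coords_of_mulEquiv hG h φ
    exact hE.isElementaryTwoAbelian hcop he hχ
  · rintro d e k h ⟨φ⟩
    have : NeZero d := ⟨h.d_pos.ne'⟩
    have : NeZero e := ⟨h.e_pos.ne'⟩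
    obtain ⟨hcop, hd, he, χ, hχ1, hχ, E, hE⟩ := exists_coords_of_mulEquiv hG h φ
    have hgd : ordMod k (gOf e k) ∣ d := h.ord_eq ▸ ordMod_dvd_ordMod gOf_dvd
    have hcard := ncard_oSet hd (he.squarefree_of_dvd gOf_dvd) hgd
    exact ⟨by rw [hE.card_T hcop he hχ, card_isTwist h.k_pos hd he hgd hχ hχ1, hcard],
      by rw [hcard, card_isClosedSet]⟩
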